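/- **Setting.** Let $y\in\mathbb R^{r_y}$ and $u\in\mathbb R^{r_u}$ be random vectors on a common probability space, with zero mean and identity covariance, uncorrelated with each other, such that for all matrices $W,V$ the vector $Wy+Vu$ has the same law as $y$ if and only if $W=I$ and $V=0$. Let $x\in\mathbb R^{r_x}$ satisfy the affine surjective model $x=Ay+Bu+c$ and $y=Dx+e$ with $DB=0$, $DA=I$, $Dc=-e$, $\operatorname{rank}A=r_y<r_x$ and $\operatorname{rank}B\le r_x-r_y$. Let $\rho^x,\rho^y$ be the laws of $x,y$ and let $r_c=\operatorname{rank}\mathbb E[xx^\top]$. The affine Gaussian CycleCVAE has parameters $\theta=(W_x,W_y,V_x,b_x,b_y)$, $\phi=(W_z,b_z,s)$ with $s\in\mathbb R^{r_z}$, $s_k\neq 0$ for all $k$, and a noise level $\gamma>0$. Put $h_\theta(y,z)=W_xy+V_xz+b_x$, $h_\theta^+(x)=W_yx+b_y$ and $q_\phi(z|x)=\mathcal N(W_zx+b_z,\operatorname{diag}(s)^2)$. The objective is $\ell_{\rm cycle}=\ell_x+\ell_y$, where $$\ell_x=\int\Big\{\mathbb E_{q_\phi(z|x)}\big[\tfrac1\gamma\|x-h_\theta(h_\theta^+(x),z)\|_2^2\big]+r_x\log\gamma+\sum_{k=1}^{r_z}(s_k^2-\log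 s_k^2)+\|W_zx+b_z\|_2^2\Big\}\,\rho^x(dx),$$ $$\ell_y=\int\big(\epsilon_y^\top\Sigma_{\epsilon_y}^{-1}\epsilon_y+\log|\Sigma_{\epsilon_y}|\big)\,\rho^y(dy),$$ $$\epsilon_y=(I-W_yW_x)y-W_yb_x-b_y,\qquad \Sigma_{\epsilon_y}=\gamma I+W_yV_xV_x^\top W_y^\top.$$ Minima are taken subject to the constraint that $\hat y=h_\theta^+(x)$, $x\sim\rho^x$, has law $\rho^y$. **Claim.** Assume $r_z\ge r_c-r_y$. Say that $\theta^*$ *recovers the ground truth* if $W_x^*=A$; $V_x^*=[\widetilde B,0]P$, where $\widetilde B$ has $\operatorname{rank}B$ columns, $\operatorname{span}\widetilde B=\operatorname{span}B$ (column spans) and $P$ is a permutation matrix; $b_x^*=c$; and $W_y^*=\widetilde D$, $b_y^*=-\widetilde Dc$ for some $\widetilde D$ with $\widetilde DA=I$ and $\widetilde DB=0$. Then: 1. For every fixed $\gamma>0$, the constrained problem over $(\theta,\phi)$ has a global minimum, and every local minimum is global. 2. There is $\gamma_0>0$ such that for every $0<\gamma<\gamma_0$ every global minimum $(\theta^*,\phi^*)$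 at noise level $\gamma$ has $\theta^*$ recovering the ground truth. 3. If $\gamma_n\to0$, $\gamma_n>0$, and $(\theta_n,\phi_n)$ is a global minimum at noise level $\gamma_n$ with $V_x$-matrix $V_n$, then $V_nV_n^\top\to BB^\top$; and if moreover $\theta_n\to\theta^*$, then $\theta^*$ recovers the ground truth. 4. If $r_y\ge1$ and $\gamma>0$ is trained as well, the constrained problem over $(\theta,\phi,\gamma)$ has no local minimum, and the optimal value at noise level $\gamma$ tends to $-\infty$ as $\gamma\to0$. So minima are only approached in the limit $\gamma\to0$. -/

import Mathlib

open MeasureTheory ProbabilityTheory Filter Topology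
open scoped Matrix

namespace CycleCVAE

/-- The squared Euclidean norm of a vector. -/
def sqNorm {n : ℕ} (v : Fin n → ℝ) : ℝ := v ⬝ᵥ v

/-- The generative parameters `θ` (apart from the noise level `γ`, which is kept as a separate
argument): `h_θ(y, z) = Wx y + Vx z + bx` and `h_θ⁺(x) = Wy x + by`. -/
@[ext]
structure Decoder (rx ry rz : ℕ) where
  Wx : Matrix (Fin rx) (Fin ry) ℝ
  Wy : Matrix (Fin ry) (Fin rx) ℝ
  Vx : Matrix (Fin rx) (Fin rz) ℝ
  bx : Fin rx → ℝ
  b_y : Fin ry → ℝ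

/-- The encoder parameters `φ`: `q_φ(z | x) = N(Wz x + bz, diag(s)²)`. -/
@[ext]
structure Encoder (rx rz : ℕ) where
  Wz : Matrix (Fin rz) (Fin rx) ℝ
  bz : Fin rz → ℝ
  s : Fin rz → ℝ

/-- The usual (product) topology on the finite-dimensional space of generative parameters. -/
instance (rx ry rz : ℕ) : TopologicalSpace (Decoder rx ry rz) :=
  TopologicalSpace.induced (fun θ => (θ.Wx, θ.Wy, θ.Vx, θ.bx, θ.b_y)) inferInstance

/-- The usual (product) topology on the finite-dimensional space of encoder parameters. -/
instance (rx rz : ℕ) : TopologicalSpace (Encoder rx rz) :=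
  TopologicalSpace.induced (fun φ => (φ.Wz, φ.bz, φ.s)) inferInstance

/-- All trainable parameters `(θ, φ)` other than `γ`. -/
abbrev Params (rx ry rz : ℕ) : Type := Decoder rx ry rz × Encoder rx rz

section Model

variable {rx ry rz : ℕ}

/-- `h_θ(y, z) = Wx y + Vx z + bx`. -/
def Decoder.h (θ : Decoder rx ry rz) (y : Fin ry → ℝ) (z : Fin rz → ℝ) : Fin rx → ℝ :=
  θ.Wx *ᵥ y + θ.Vx *ᵥ z + θ.bx

/-- `h_θ⁺(x) = Wy x + by`. -/
def Decoder.hPlus (θ : Decoder rx ry rz) (x : Fin rx → ℝ) : Fin ry → ℝ :=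
  θ.Wy *ᵥ x + θ.b_y

/-- The mean `Wz x + bz` of the encoder distribution. -/
def Encoder.mean (φ : Encoder rx rz) (x : Fin rx → ℝ) : Fin rz → ℝ :=
  φ.Wz *ᵥ x + φ.bz

/-- The encoder distribution `q_φ(z | x) = N(Wz x + bz, diag(s)²)`: the coordinates of `z` are
independent Gaussians. -/
noncomputable def Encoder.q (φ : Encoder rx rz) (x : Fin rx → ℝ) : Measure (Fin rz → ℝ) :=
  Measure.pi fun k => gaussianReal (φ.mean x k) (Real.toNNReal (φ.s k ^ 2))

/-- The conditional VAE energy `ℓ_x(θ, φ)` of the cycle `x → ŷ → x̂` at noise level `γ`, with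
`ŷ = h_θ⁺(x)` and decoder `N(h_θ(ŷ, z), γ I)`. -/
noncomputable def lossX (ρx : Measure (Fin rx → ℝ)) (p : Params rx ry rz) (γ : ℝ) : ℝ :=
  ∫ x, ((∫ z, 1 / γ * sqNorm (x - p.1.h (p.1.hPlus x) z) ∂(p.2.q x))
    + rx * Real.log γ
    + ∑ k, (p.2.s k ^ 2 - Real.log (p.2.s k ^ 2))
    + sqNorm (p.2.mean x)) ∂ρx

/-- The residual `ε_y = y - h_θ⁺(h_θ(y, 0)) = (I - Wy Wx) y - Wy bx - by`. -/
def Decoder.epsY (θ : Decoder rx ry rz) (y : Fin ry → ℝ) : Fin ry → ℝ :=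
  (1 - θ.Wy * θ.Wx) *ᵥ y - θ.Wy *ᵥ θ.bx - θ.b_y

/-- The covariance `Σ_{ε_y} = γ I + Wy Vx Vxᵀ Wyᵀ`. -/
def Decoder.sigmaY (θ : Decoder rx ry rz) (γ : ℝ) : Matrix (Fin ry) (Fin ry) ℝ :=
  γ • (1 : Matrix (Fin ry) (Fin ry) ℝ) + θ.Wy * θ.Vx * θ.Vxᵀ * θ.Wyᵀ

/-- The loss `ℓ_y(θ)` of the cycle `y → x̂ → ŷ` at noise level `γ`. -/
noncomputable def lossY (ρy : Measure (Fin ry → ℝ)) (θ : Decoder rx ry rz) (γ : ℝ) : ℝ :=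
  ∫ y, (θ.epsY y ⬝ᵥ ((θ.sigmaY γ)⁻¹ *ᵥ θ.epsY y) + Real.log (θ.sigmaY γ).det) ∂ρy

/-- The cycle-consistent objective `ℓ_cycle = ℓ_x + ℓ_y` at noise level `γ`. -/
noncomputable def cycleLoss (ρx : Measure (Fin rx → ℝ)) (ρy : Measure (Fin ry → ℝ))
    (γ : ℝ) (p : Params rx ry rz) : ℝ :=
  lossX ρx p γ + lossY ρy p.1 γ

/-- The feasible parameters: the encoder Gaussian is nondegenerate (so that every `log s_k²` is
finite), and the distribution of `ŷ = h_θ⁺(x)`, `x ∼ ρx`, equals `ρy`. -/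
def feasible (rz : ℕ) (ρx : Measure (Fin rx → ℝ)) (ρy : Measure (Fin ry → ℝ)) :
    Set (Params rx ry rz) :=
  {p | (∀ k, p.2.s k ≠ 0) ∧ ρx.map p.1.hPlus = ρy}

/-- `p` is a local minimum of the constrained problem at noise level `γ`. -/
def IsLocalMinimizer (ρx : Measure (Fin rx → ℝ)) (ρy : Measure (Fin ry → ℝ)) (γ : ℝ)
    (p : Params rx ry rz) : Prop :=
  p ∈ feasible rz ρx ρy ∧ IsLocalMinOn (cycleLoss ρx ρy γ) (feasible rz ρx ρy) p

/-- `p` is a global minimum of the constrained problem at noise level `γ`. -/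
def IsGlobalMinimizer (ρx : Measure (Fin rx → ℝ)) (ρy : Measure (Fin ry → ℝ)) (γ : ℝ)
    (p : Params rx ry rz) : Prop :=
  p ∈ feasible rz ρx ρy ∧ IsMinOn (cycleLoss ρx ρy γ) (feasible rz ρx ρy) p

/-- `(p, γ)` is a local minimum of the constrained problem in which the noise level `γ > 0` is
trained together with the other parameters. -/
def IsJointLocalMinimizer (ρx : Measure (Fin rx → ℝ)) (ρy : Measure (Fin ry → ℝ))
    (p : Params rx ry rz) (γ : ℝ) : Prop :=
  p ∈ feasible rz ρx ρy ∧ 0 < γ ∧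
    IsLocalMinOn (fun t : Params rx ry rz × ℝ => cycleLoss ρx ρy t.2 t.1)
      (feasible rz ρx ρy ×ˢ Set.Ioi 0) (p, γ)

/-- The second moment matrix `E[x xᵀ]`, `x ∼ ρ`. -/
noncomputable def secondMoment (ρ : Measure (Fin rx → ℝ)) : Matrix (Fin rx) (Fin rx) ℝ :=
  Matrix.of fun i j => ∫ x, x i * x j ∂ρ

/-- The block matrix `[M, 0]` with `n` columns (for `k ≤ n`). -/
def padCols {m k : ℕ} (M : Matrix (Fin m) (Fin k) ℝ) (n : ℕ) : Matrix (Fin m) (Fin n) ℝ :=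
  Matrix.of fun i j => if h : (j : ℕ) < k then M i ⟨j, h⟩ else 0

end Model

/-- The affine surjective model: random vectors `x, y, u` with `x = A y + B u + c` and
`y = D x + e`, where `y` and `u` are centered with identity covariance and uncorrelated, and
`W y + V u` is distributed like `y` only for `W = I`, `V = 0`. -/
structure AffineSurjectiveModel {Ω : Type*} [MeasurableSpace Ω] (μ : Measure Ω) {rx ry ru : ℕ}
    (x : Ω → Fin rx → ℝ) (y : Ω → Fin ry → ℝ) (u : Ω → Fin ru → ℝ)
    (A : Matrix (Fin rx) (Fin ry) ℝ) (B : Matrix (Fin rx) (Fin ru) ℝ) (c : Fin rx → ℝ)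
    (D : Matrix (Fin ry) (Fin rx) ℝ) (e : Fin ry → ℝ) : Prop where
  x_eq : ∀ᵐ ω ∂μ, x ω = A *ᵥ y ω + B *ᵥ u ω + c
  y_eq : ∀ᵐ ω ∂μ, y ω = D *ᵥ x ω + e
  D_mul_B : D * B = 0
  D_mul_A : D * A = 1
  D_mulVec_c : D *ᵥ c = -e
  rank_A : A.rank = ry
  ry_lt_rx : ry < rx
  rank_B : B.rank ≤ rx - ry
  memLp_y : ∀ i, MemLp (fun ω => y ω i) 2 μ
  memLp_u : ∀ j, MemLp (fun ω => u ω j) 2 μ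
  mean_y : ∀ i, ∫ ω, y ω i ∂μ = 0
  mean_u : ∀ j, ∫ ω, u ω j ∂μ = 0
  cov_y : ∀ i j, cov[fun ω => y ω i, fun ω => y ω j; μ] = (1 : Matrix (Fin ry) (Fin ry) ℝ) i j
  cov_u : ∀ i j, cov[fun ω => u ω i, fun ω => u ω j; μ] = (1 : Matrix (Fin ru) (Fin ru) ℝ) i j
  cov_y_u : ∀ i j, cov[fun ω => y ω i, fun ω => u ω j; μ] = 0
  identifiable : ∀ (W : Matrix (Fin ry) (Fin ry) ℝ) (V : Matrix (Fin ry) (Fin ru) ℝ),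
    μ.map (fun ω => W *ᵥ y ω + V *ᵥ u ω) = μ.map y ↔ W = 1 ∧ V = 0

/-- `θ` recovers the ground truth: `Wx = A`, `Vx = [B̃, 0] P` with `B̃` having `rank B` columns and
the same column span as `B` and `P` a permutation matrix, `bx = c`, and `Wy = D̃`, `by = -D̃ c` for
some `D̃` with `D̃ A = I` and `D̃ B = 0`. -/
def Recovers {rx ry rz ru : ℕ} (θ : Decoder rx ry rz) (A : Matrix (Fin rx) (Fin ry) ℝ)
    (B : Matrix (Fin rx) (Fin ru) ℝ) (c : Fin rx → ℝ) : Prop :=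
  θ.Wx = A ∧
  (B.rank ≤ rz ∧ ∃ (Bt : Matrix (Fin rx) (Fin B.rank) ℝ) (σ : Equiv.Perm (Fin rz)),
    Submodule.span ℝ (Set.range Bt.col) = Submodule.span ℝ (Set.range B.col) ∧
    θ.Vx = padCols Bt rz * σ.permMatrix ℝ) ∧
  θ.bx = c ∧
  ∃ Dt : Matrix (Fin ry) (Fin rx) ℝ, Dt * A = 1 ∧ Dt * B = 0 ∧ θ.Wy = Dt ∧ θ.b_y = -(Dt *ᵥ c)

end CycleCVAE

/-!
On the feasible set the law of `ŷ` forces `Wy A = I`, `Wy B = 0` and `by = -Wy c`: comparing means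
gives the offset and identifiability gives the rest (`AffineSurjectiveModel.feasible_iff`). Then
`ŷ = y`, and since `(1, y, u)` is white the cycle loss is an explicit function `core` of the
deviation `N` of `[bx, Wx]` from `[c, A]`, the response `R` of the encoder to `(1, y)`, the decoder
matrix `V = Vx`, the encoder `K` on the columns of `B`, and the deviations `s`
(`AffineSurjectiveModel.cycleLoss_eq`). As `D A = I` and `D B = 0`, these can be varied freely.

At a local minimum, scaling `N` and `R` towards zero shows `N = 0` and `R = 0`
(`core_local_centered`), and shrinking the component of `V` orthogonal to the columns of `B` shows
that `V = B Z` (`core_local_range`), so `Wy V = 0`. What remains is the linear VAE objective `vae`.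
There, rotating two columns of `V` changes only `∑ log (1 + |v|² / γ)`, which forces the columns to
be orthogonal (`vae_local_orth`); first-order conditions give the encoder, the variances, and
`B Bᵀ V = S V` with `S = γ I + V Vᵀ`; and a second-order variation through a vanishing column of `V`
gives `B Bᵀ ≤ S` (`vae_local_escape`). If no column vanishes, then `V` already has the rank of `B`,
because `rz ≥ rank B`. These conditions are `IsOpt`.

Conversely, the tangent inequality for the concave function `log det` and Hadamard's inequality show
that every `S ≥ B Bᵀ` yields a lower bound for `vae` (`le_vae`), and under `IsOpt` the bound for
`S = γ I + V Vᵀ` is attained. Hence local minima are global, and the spectral theorem provides one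
(`exists_isOpt`).

If `γ` is below the smallest nonzero eigenvalue of `B Bᵀ`, the columns of an optimal `V` span those
of `B` (`IsOpt.exists_eq_mul`), and being orthogonal, exactly `rank B` of them are nonzero; this is
the form `[B̃, 0] P`. Moreover `V Vᵀ = B Bᵀ - γ Π` with the projection `Π` to the column space of
`B` (`IsOpt.mul_transpose_eq`), which gives the limit `γ → 0`.

When `γ` is trained as well, a local minimum would satisfy `IsOpt` and be critical in `γ`. The
reconstruction error of an optimum is at most `rx γ`, while criticality asks for `(rx + ry) γ`, so
there is none if `ry ≥ 1`. Finally, at most `rank B ≤ rx - ry` columns of `V` contribute `-log γ`,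
against `(rx + ry) log γ` from the two Gaussian normalizations, so the optimal value is at most
`2 ry log γ + O(1)` (`AffineSurjectiveModel.cycleLoss_le`).
-/

/-! ### Squared Frobenius norm and log-determinants -/

namespace CycleCVAE

variable {m n k u e : Type*} [Fintype m] [Fintype n] [Fintype k] [Fintype u] [Fintype e]

/-- The squared Frobenius norm of a matrix. -/
def frob (X : Matrix m n ℝ) : ℝ := (Xᵀ * X).trace

theorem frob_eq_sum (X : Matrix m n ℝ) : frob X = ∑ j, ∑ i, X i j ^ 2 := by
  simp [frob, Matrix.trace, Matrix.mul_apply, sq]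

theorem frob_nonneg (X : Matrix m n ℝ) : 0 ≤ frob X := by
  rw [frob_eq_sum]; positivity

theorem frob_eq_zero {X : Matrix m n ℝ} : frob X = 0 ↔ X = 0 := by
  simpa [frob] using Matrix.trace_conjTranspose_mul_self_eq_zero_iff (A := X)

theorem frob_zero : frob (0 : Matrix m n ℝ) = 0 := frob_eq_zero.2 rfl

theorem frob_neg (X : Matrix m n ℝ) : frob (-X) = frob X := by simp [frob]

theorem frob_smul (t : ℝ) (X : Matrix m n ℝ) : frob (t • X) = t ^ 2 * frob X := by
  simp [frob, sq, mul_assoc]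

theorem trace_transpose_mul_comm (X Y : Matrix m n ℝ) :
    (Yᵀ * X).trace = (Xᵀ * Y).trace := by
  rw [← Matrix.trace_transpose (Yᵀ * X)]; simp [Matrix.transpose_mul]

theorem frob_add (X Y : Matrix m n ℝ) :
    frob (X + Y) = frob X + 2 * (Xᵀ * Y).trace + frob Y := by
  simp only [frob, Matrix.transpose_add, Matrix.add_mul, Matrix.mul_add, Matrix.trace_add]
  rw [trace_transpose_mul_comm X Y]; ring

theorem frob_sub (X Y : Matrix m n ℝ) :
    frob (X - Y) = frob X - 2 * (Xᵀ * Y).trace + frob Y := by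
  rw [sub_eq_add_neg, frob_add, frob_neg]; simp; ring

theorem frob_add_smul (X Y : Matrix m n ℝ) (t : ℝ) :
    frob (X + t • Y) = frob X + 2 * t * (Xᵀ * Y).trace + t ^ 2 * frob Y := by
  rw [frob_add, frob_smul, Matrix.mul_smul, Matrix.trace_smul, smul_eq_mul, mul_assoc]

theorem frob_transpose (X : Matrix m n ℝ) : frob Xᵀ = frob X := by
  simp [frob, Matrix.trace_mul_comm X]

theorem posSemidef_mul_transpose (X : Matrix m n ℝ) : (X * Xᵀ).PosSemidef := by
  simpa using Matrix.posSemidef_self_mul_conjTranspose X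

theorem posDef_smul_one_add {n : Type*} [DecidableEq n] {γ : ℝ} (hγ : 0 < γ) {T : Matrix n n ℝ}
    (hT : T.PosSemidef) :
    (γ • (1 : Matrix n n ℝ) + T).PosDef :=
  (Matrix.PosDef.one.smul hγ).add_posSemidef hT

open scoped MatrixOrder in
/-- Real positive semidefinite matrices are Gram matrices. -/
theorem exists_transpose_mul_self [DecidableEq n] {P : Matrix n n ℝ} (hP : P.PosSemidef) :
    ∃ F : Matrix n n ℝ, P = Fᵀ * F := by
  obtain ⟨F, hF⟩ := CStarAlgebra.nonneg_iff_eq_star_mul_self.1 hP.nonneg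
  exact ⟨F, by simpa [Matrix.star_eq_conjTranspose] using hF⟩

theorem trace_mul_nonneg [DecidableEq n] {P Q : Matrix n n ℝ} (hP : P.PosSemidef)
    (hQ : Q.PosSemidef) : 0 ≤ (P * Q).trace := by
  obtain ⟨F, rfl⟩ := exists_transpose_mul_self hP
  rw [Matrix.mul_assoc, Matrix.trace_mul_comm, ← Matrix.conjTranspose_eq_transpose_of_trivial]
  exact (hQ.mul_mul_conjTranspose_same F).trace_nonneg

theorem trace_quadratic_nonneg {P : Matrix n n ℝ} (hP : P.PosSemidef) (X : Matrix n m ℝ) :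
    0 ≤ (Xᵀ * P * X).trace := by
  rw [← Matrix.conjTranspose_eq_transpose_of_trivial]
  exact (hP.conjTranspose_mul_mul_same X).trace_nonneg

/-- Sum `log t ≤ t - 1` over the eigenvalues. -/
theorem log_det_le_trace [DecidableEq n] {M : Matrix n n ℝ} (hM : M.PosDef) :
    Real.log M.det ≤ M.trace - Fintype.card n := by
  have hd := hM.1.det_eq_prod_eigenvalues
  have ht := hM.1.trace_eq_sum_eigenvalues
  simp only [RCLike.ofReal_real_eq_id, id] at hd ht
  rw [hd, ht, Real.log_prod (fun i _ => (hM.eigenvalues_pos i).ne')]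
  calc ∑ i, Real.log (hM.1.eigenvalues i) ≤ ∑ i, (hM.1.eigenvalues i - 1) :=
        Finset.sum_le_sum fun i _ => Real.log_le_sub_one_of_pos (hM.eigenvalues_pos i)
    _ = _ := by simp

/-- Concavity of `log det`, in the form of the tangent inequality at `Y`. -/
theorem log_det_le [DecidableEq n] {X Y : Matrix n n ℝ} (hX : X.PosDef) (hY : Y.PosDef) :
    Real.log X.det ≤ Real.log Y.det + (Y⁻¹ * X).trace - Fintype.card n := by
  obtain ⟨F, hF⟩ := exists_transpose_mul_self hY.inv.posSemidef
  have hYu : IsUnit Y.det := (Matrix.isUnit_iff_isUnit_det _).1 hY.isUnit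
  have hFd : F.det * F.det = Y.det⁻¹ := by
    have := congrArg Matrix.det hF
    rw [Matrix.det_mul, Matrix.det_transpose, Matrix.det_nonsing_inv, Ring.inverse_eq_inv'] at this
    exact this.symm
  have hYd := hY.det_pos
  have hF0 : F.det ≠ 0 := by
    intro h; rw [h] at hFd; simp at hFd; exact hYd.ne hFd
  have hFt : IsUnit Fᵀ := by
    rw [Matrix.isUnit_iff_isUnit_det, Matrix.det_transpose]; exact hF0.isUnit
  have hM : (F * X * Fᵀ).PosDef := by
    have := hX.conjTranspose_mul_mul_same (B := Fᵀ) (Matrix.mulVec_injective_of_isUnit hFt)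
    simpa using this
  have h1 := log_det_le_trace hM
  have h2 : (F * X * Fᵀ).det = X.det * Y.det⁻¹ := by
    rw [Matrix.det_mul, Matrix.det_mul, Matrix.det_transpose, ← hFd]; ring
  have h3 : (F * X * Fᵀ).trace = (Y⁻¹ * X).trace := by
    rw [Matrix.trace_mul_comm, ← Matrix.mul_assoc, hF]
  rw [h2, h3, Real.log_mul hX.det_pos.ne' (inv_ne_zero hYd.ne'), Real.log_inv] at h1
  linarith

/-- Hadamard's inequality for positive definite matrices. -/
theorem log_det_le_sum_diag [DecidableEq n] {X : Matrix n n ℝ} (hX : X.PosDef) :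
    Real.log X.det ≤ ∑ i, Real.log (X i i) := by
  have hp : ∀ i, 0 < X i i := fun i => hX.diag_pos
  have hD : (Matrix.diagonal fun i => X i i).PosDef := Matrix.PosDef.diagonal hp
  have h := log_det_le hX hD
  have hinv : (Matrix.diagonal fun i => X i i)⁻¹ = Matrix.diagonal fun i => (X i i)⁻¹ := by
    apply Matrix.inv_eq_right_inv
    rw [Matrix.diagonal_mul_diagonal, ← Matrix.diagonal_one]
    congr 1; ext i; exact mul_inv_cancel₀ (hp i).ne'
  have ht : ((Matrix.diagonal fun i => X i i)⁻¹ * X).trace = Fintype.card n := by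
    rw [hinv, Matrix.trace]
    simp [Matrix.diagonal_mul, fun i => inv_mul_cancel₀ (hp i).ne']
  rw [ht, Matrix.det_diagonal, Real.log_prod (fun i _ => (hp i).ne')] at h
  linarith

/-- `log det (γ I + T)` is at least its value at `T = 0`. -/
theorem card_mul_log_le_log_det [DecidableEq n] {γ : ℝ} (hγ : 0 < γ) {T : Matrix n n ℝ}
    (hT : T.PosSemidef) :
    Fintype.card n * Real.log γ ≤ Real.log (γ • (1 : Matrix n n ℝ) + T).det := by
  have hS := posDef_smul_one_add hγ hT
  have h := log_det_le (posDef_smul_one_add hγ (Matrix.PosSemidef.zero (n := n))) hS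
  have hu : IsUnit (γ • (1 : Matrix n n ℝ) + T).det :=
    (Matrix.isUnit_iff_isUnit_det _).1 hS.isUnit
  set S := γ • (1 : Matrix n n ℝ) + T
  have h1 : S⁻¹ * (γ • (1 : Matrix n n ℝ) + 0) = 1 - S⁻¹ * T := by
    have : γ • (1 : Matrix n n ℝ) + 0 = S - T := by simp [S]
    rw [this, Matrix.mul_sub, Matrix.nonsing_inv_mul S hu]
  rw [h1, Matrix.trace_sub, Matrix.trace_one, add_zero, Matrix.det_smul, Matrix.det_one, mul_one,
    Real.log_pow] at h
  have := trace_mul_nonneg hS.inv.posSemidef hT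
  linarith

/-- `log det (γ I + t T)` does not exceed `log det (γ I + T)` for `0 ≤ t ≤ 1`. -/
theorem log_det_shrink_le [DecidableEq n] {γ : ℝ} (hγ : 0 < γ) {T : Matrix n n ℝ}
    (hT : T.PosSemidef) {t : ℝ} (h0 : 0 ≤ t) (h1 : t ≤ 1) :
    Real.log (γ • (1 : Matrix n n ℝ) + t • T).det ≤
      Real.log (γ • (1 : Matrix n n ℝ) + T).det := by
  have hS := posDef_smul_one_add hγ hT
  have h := log_det_le (posDef_smul_one_add hγ (hT.smul h0)) hS
  have hu : IsUnit (γ • (1 : Matrix n n ℝ) + T).det :=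
    (Matrix.isUnit_iff_isUnit_det _).1 hS.isUnit
  set S := γ • (1 : Matrix n n ℝ) + T
  have h2 : S⁻¹ * (γ • (1 : Matrix n n ℝ) + t • T) = 1 - (1 - t) • (S⁻¹ * T) := by
    have : γ • (1 : Matrix n n ℝ) + t • T = S - (1 - t) • T := by simp [S, sub_smul]; abel
    rw [this, Matrix.mul_sub, Matrix.nonsing_inv_mul S hu, Matrix.mul_smul]
  rw [h2, Matrix.trace_sub, Matrix.trace_one, Matrix.trace_smul, smul_eq_mul] at h
  have := mul_nonneg (sub_nonneg.2 h1) (trace_mul_nonneg hS.inv.posSemidef hT)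
  linarith

/-- The normal equations of a least squares problem are solvable. -/
theorem exists_normal_eq {ι : Type*} (B : Matrix n u ℝ) (V : Matrix n ι ℝ) :
    ∃ Z : Matrix u ι ℝ, Bᵀ * B * Z = Bᵀ * V := by
  have hle : LinearMap.range (Bᵀ * B).mulVecLin ≤ LinearMap.range Bᵀ.mulVecLin := by
    rw [Matrix.mulVecLin_mul]; exact LinearMap.range_comp_le_range _ _
  have heq := Submodule.eq_of_le_of_finrank_eq hle (by
    have := Matrix.rank_transpose_mul_self B
    rw [← Matrix.rank_transpose B] at this
    exact this)
  have hcol : ∀ j, ∃ z, (Bᵀ * B) *ᵥ z = Bᵀ *ᵥ V.col j := fun j => by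
    have : Bᵀ *ᵥ V.col j ∈ LinearMap.range (Bᵀ * B).mulVecLin := by
      rw [heq]; exact ⟨_, rfl⟩
    exact this
  choose z hz using hcol
  refine ⟨Matrix.of fun i j => z j i, ?_⟩
  ext i j
  exact congrFun (hz j) i

end CycleCVAE

/-! ### The reduced objective -/

namespace CycleCVAE

variable {m n k u e : Type*} [Fintype m] [Fintype n] [Fintype k] [Fintype u] [Fintype e]

/-- The linear VAE objective: `V` decodes, `Q` encodes and `s` holds the encoder deviations. -/
noncomputable def vae [DecidableEq k] (γ : ℝ) (B : Matrix n u ℝ) (V : Matrix n k ℝ)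
    (Q : Matrix k u ℝ) (s : k → ℝ) : ℝ :=
  γ⁻¹ * (frob (B - V * Q) + frob (V * Matrix.diagonal s)) + frob Q
    + ∑ i, (s i ^ 2 - Real.log (s i ^ 2))

/-- The cycle loss as a function of the free parameters of a feasible point. `N` is the deviation of
`[bx, Wx]` from `[c, A]`, `R` is the response of the encoder mean to `(1, y)`, `V` decodes `z`, and
`K` is the encoder matrix, of which only `K B` matters. The last two terms are the loss of the cycle
that starts from `y`. -/
noncomputable def core [DecidableEq m] [DecidableEq k] (γ : ℝ) (B : Matrix n u ℝ)
    (Wy : Matrix m n ℝ) (N : Matrix n e ℝ) (R : Matrix k e ℝ) (V : Matrix n k ℝ)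
    (K : Matrix k n ℝ) (s : k → ℝ) : ℝ :=
  γ⁻¹ * frob (N + V * R) + frob R + vae γ B V (K * B) s + Fintype.card n * Real.log γ
    + ((Wy * N)ᵀ * (γ • (1 : Matrix m m ℝ) + Wy * V * Vᵀ * Wyᵀ)⁻¹ * (Wy * N)).trace
    + Real.log (γ • (1 : Matrix m m ℝ) + Wy * V * Vᵀ * Wyᵀ).det

theorem posSemidef_sandwich (Wy : Matrix m n ℝ) (V : Matrix n k ℝ) :
    (Wy * V * Vᵀ * Wyᵀ).PosSemidef := by
  have := posSemidef_mul_transpose (Wy * V)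
  simpa [Matrix.transpose_mul, Matrix.mul_assoc] using this

theorem frob_mul_diagonal [DecidableEq k] (V : Matrix n k ℝ) (s : k → ℝ) :
    frob (V * Matrix.diagonal s) = ∑ i, s i ^ 2 * (Vᵀ * V) i i := by
  simp only [frob_eq_sum, Matrix.mul_diagonal]
  simp only [Matrix.mul_apply, Matrix.transpose_apply, Finset.mul_sum]
  exact Finset.sum_congr rfl fun j _ => Finset.sum_congr rfl fun i _ => by ring

theorem vae_eq_sum [DecidableEq k] (γ : ℝ) (B : Matrix n u ℝ) (V : Matrix n k ℝ)
    (Q : Matrix k u ℝ) (s : k → ℝ) :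
    vae γ B V Q s = γ⁻¹ * frob (B - V * Q) + frob Q
      + ∑ i, (s i ^ 2 * (1 + γ⁻¹ * (Vᵀ * V) i i) - Real.log (s i ^ 2)) := by
  rw [vae, frob_mul_diagonal]
  have : ∑ i, (s i ^ 2 * (1 + γ⁻¹ * (Vᵀ * V) i i) - Real.log (s i ^ 2))
      = γ⁻¹ * ∑ i, s i ^ 2 * (Vᵀ * V) i i + ∑ i, (s i ^ 2 - Real.log (s i ^ 2)) := by
    rw [Finset.mul_sum, ← Finset.sum_add_distrib]
    exact Finset.sum_congr rfl fun i _ => by ring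
  rw [this]; ring

theorem gram_diag_nonneg {k : Type*} (V : Matrix n k ℝ) (i : k) : 0 ≤ (Vᵀ * V) i i := by
  simp only [Matrix.mul_apply, Matrix.transpose_apply]
  exact Finset.sum_nonneg fun _ _ => mul_self_nonneg _

/-- Ridge regression: completing the square around `Q = Vᵀ P`, where `(γ I + V Vᵀ) P = B`. -/
theorem ridge {γ : ℝ} (hγ : 0 < γ) {B P : Matrix n u ℝ} {V : Matrix n k ℝ} (E : Matrix k u ℝ)
    (hP : γ • P + V * (Vᵀ * P) = B) :
    γ⁻¹ * frob (B - V * (Vᵀ * P + E)) + frob (Vᵀ * P + E)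
      = (Bᵀ * P).trace + (γ⁻¹ * frob (V * E) + frob E) := by
  have h1 : B - V * (Vᵀ * P + E) = γ • P - V * E := by
    rw [← hP, Matrix.mul_add]; abel
  have h2 : (Bᵀ * P).trace = γ * frob P + frob (Vᵀ * P) := by
    rw [← hP]
    simp [frob, Matrix.add_mul, Matrix.transpose_mul, Matrix.mul_assoc]
  rw [h1, h2, frob_sub, frob_add, frob_smul]
  have h3 : ((γ • P)ᵀ * (V * E)).trace = γ * ((Vᵀ * P)ᵀ * E).trace := by
    simp [Matrix.transpose_mul, Matrix.mul_assoc]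
  rw [h3]
  field_simp
  ring

theorem isLocalMinOn_eventually_path {α : Type*} [TopologicalSpace α] {f : α → ℝ} {t : Set α}
    {a : α} (h : IsLocalMinOn f t a) {g : ℝ → α} (hg : ContinuousAt g 0) (h0 : g 0 = a)
    (ht : ∀ᶠ x in 𝓝 0, g x ∈ t) : ∀ᶠ x in 𝓝 (0 : ℝ), f a ≤ f (g x) := by
  subst h0
  have h1 := (eventually_nhdsWithin_iff.1 h)
  filter_upwards [hg.eventually h1, ht] with x hx hx' using hx hx'

theorem linear_coeff_eq_zero {β δ : ℝ} (h : ∀ᶠ t in 𝓝 (0 : ℝ), 0 ≤ β * t + δ * t ^ 2) :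
    β = 0 := by
  have hmin : IsLocalMin (fun t : ℝ => β * t + δ * t ^ 2) 0 := by
    filter_upwards [h] with t ht; simpa using ht
  have hd : HasDerivAt (fun t : ℝ => β * t + δ * t ^ 2) β 0 := by
    have := ((hasDerivAt_id' (0 : ℝ)).const_mul β).fun_add
      (((hasDerivAt_id' (0 : ℝ)).fun_pow 2).const_mul δ)
    simpa using this
  exact hmin.hasDerivAt_eq_zero hd

/-- The coefficient of a quadratic term that shrinking by `1 - t` cannot decrease is not positive.
-/
theorem nonpos_of_shrink {q : ℝ}
    (h : ∀ᶠ t in 𝓝 (0 : ℝ), 0 < t → t < 1 → 0 ≤ ((1 - t) ^ 2 - 1) * q) : q ≤ 0 := by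
  obtain ⟨ε, hε, hh⟩ := Metric.eventually_nhds_iff.1 h
  have h1 : 0 < min (ε / 2) (1 / 2) := by positivity
  have h2 := hh (y := min (ε / 2) (1 / 2)) (by
    rw [Real.dist_eq, sub_zero, abs_of_pos h1]
    linarith [min_le_left (ε / 2) (1 / 2)]) h1 (by linarith [min_le_right (ε / 2) (1 / 2)])
  set t := min (ε / 2) (1 / 2)
  have h3 : t ≤ 1 / 2 := min_le_right _ _
  by_contra! hq
  nlinarith [mul_pos h1 hq]

section Local

variable [DecidableEq m] [DecidableEq k]

/-- `N` and `R` enter the objective only through nonnegative quadratic forms, which scaling both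
towards zero decreases, so they vanish at a local minimum. -/
theorem core_local_centered {γ : ℝ} (hγ : 0 < γ) {B : Matrix n u ℝ} {Wy : Matrix m n ℝ}
    {N : Matrix n e ℝ} {R : Matrix k e ℝ} {V : Matrix n k ℝ} {K : Matrix k n ℝ} {s : k → ℝ}
    (h : IsLocalMin (fun a : Matrix n e ℝ × Matrix k e ℝ × Matrix n k ℝ × Matrix k n ℝ × (k → ℝ) =>
      core γ B Wy a.1 a.2.1 a.2.2.1 a.2.2.2.1 a.2.2.2.2) (N, R, V, K, s)) :
    N = 0 ∧ R = 0 := by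
  have hp := isLocalMinOn_eventually_path (h.on Set.univ)
    (g := fun t : ℝ => ((1 - t) • N, (1 - t) • R, V, K, s))
    (by fun_prop) (by simp) (by simp)
  have hS := posDef_smul_one_add hγ (posSemidef_sandwich Wy V)
  have hq1 := trace_quadratic_nonneg hS.inv.posSemidef (Wy * N)
  have hq : γ⁻¹ * frob (N + V * R) + frob R
      + ((Wy * N)ᵀ * (γ • (1 : Matrix m m ℝ) + Wy * V * Vᵀ * Wyᵀ)⁻¹ * (Wy * N)).trace ≤ 0 := by
    apply nonpos_of_shrink
    filter_upwards [hp] with t ht _ _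
    have e1 : (1 - t) • N + V * ((1 - t) • R) = (1 - t) • (N + V * R) := by
      rw [Matrix.mul_smul, smul_add]
    simp only [core, e1] at ht
    simp only [frob_smul, Matrix.mul_smul, Matrix.transpose_smul, Matrix.smul_mul,
      Matrix.trace_smul, smul_eq_mul] at ht
    linarith
  have f1 := mul_nonneg (inv_pos.2 hγ).le (frob_nonneg (N + V * R))
  have f2 := frob_nonneg R
  have hR : R = 0 := frob_eq_zero.1 (by linarith)
  refine ⟨?_, hR⟩
  have : γ⁻¹ * frob (N + V * R) = 0 := by linarith
  have := (mul_eq_zero.1 this).resolve_left (inv_pos.2 hγ).ne'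
  simpa [hR] using frob_eq_zero.1 this

theorem core_centered (γ : ℝ) (B : Matrix n u ℝ) (Wy : Matrix m n ℝ) (V : Matrix n k ℝ)
    (K : Matrix k n ℝ) (s : k → ℝ) :
    core γ B Wy (0 : Matrix n e ℝ) 0 V K s = vae γ B V (K * B) s + Fintype.card n * Real.log γ
      + Real.log (γ • (1 : Matrix m m ℝ) + Wy * V * Vᵀ * Wyᵀ).det := by
  simp [core, frob_zero]

theorem core_centered_of_mul_eq_zero (γ : ℝ) (B : Matrix n u ℝ) {Wy : Matrix m n ℝ}
    {V : Matrix n k ℝ} (hV : Wy * V = 0) (K : Matrix k n ℝ) (s : k → ℝ) :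
    core γ B Wy (0 : Matrix n e ℝ) 0 V K s = vae γ B V (K * B) s
      + (Fintype.card n + Fintype.card m) * Real.log γ := by
  rw [core_centered, hV]
  simp only [Matrix.zero_mul, add_zero, Matrix.det_smul, Matrix.det_one, Real.log_pow, mul_one]
  ring

/-- Shrinking the part `E` of `V` orthogonal to the columns of `B` lowers the reconstruction error
of the linear VAE, and it scales `Wy V`, hence does not raise the log-determinant. So `E = 0` at a
local minimum. -/
theorem core_local_range {γ : ℝ} (hγ : 0 < γ) {B : Matrix n u ℝ} {Wy : Matrix m n ℝ}
    (hB : Wy * B = 0) {V : Matrix n k ℝ} {K : Matrix k n ℝ} {s : k → ℝ} (hs : ∀ i, s i ≠ 0)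
    (h : IsLocalMin (fun a : Matrix n e ℝ × Matrix k e ℝ × Matrix n k ℝ × Matrix k n ℝ × (k → ℝ) =>
      core γ B Wy a.1 a.2.1 a.2.2.1 a.2.2.2.1 a.2.2.2.2) (0, 0, V, K, s)) :
    ∃ Z : Matrix u k ℝ, V = B * Z := by
  obtain ⟨Z, hZ⟩ := exists_normal_eq B V
  refine ⟨Z, ?_⟩
  obtain ⟨E, hE⟩ : ∃ E, E = V - B * Z := ⟨_, rfl⟩
  have hBE : Bᵀ * E = 0 := by rw [hE, Matrix.mul_sub, ← Matrix.mul_assoc, hZ, sub_self]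
  have hWE : Wy * E = Wy * V := by
    rw [hE, Matrix.mul_sub, ← Matrix.mul_assoc, hB]; simp
  have hVE : Vᵀ * E = Eᵀ * E := by
    have : V = E + B * Z := by rw [hE]; abel
    nth_rw 1 [this]
    rw [Matrix.transpose_add, Matrix.add_mul, Matrix.transpose_mul, Matrix.mul_assoc, hBE]; simp
  have hp := isLocalMinOn_eventually_path (h.on Set.univ)
    (g := fun t : ℝ => (0, 0, V - t • E, K, s))
    (by fun_prop) (by simp) (by simp)
  obtain ⟨Q, hQ⟩ : ∃ Q, Q = K * B := ⟨_, rfl⟩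
  have hT := posSemidef_sandwich Wy V
  have key : frob (E * Q) + frob (E * Matrix.diagonal s) ≤ 0 := by
    apply nonpos_of_shrink
    filter_upwards [hp] with t ht h0 h1
    simp only [core_centered, vae, ← hQ] at ht
    have a1 : B - (V - t • E) * Q = (B - V * Q) + t • (E * Q) := by
      rw [Matrix.sub_mul, Matrix.smul_mul]; abel
    have a2 : ((B - V * Q)ᵀ * (E * Q)).trace = - frob (E * Q) := by
      have : (B - V * Q)ᵀ * (E * Q) = - ((E * Q)ᵀ * (E * Q)) := by
        rw [Matrix.transpose_sub, Matrix.sub_mul, ← Matrix.mul_assoc, hBE, Matrix.transpose_mul,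
          Matrix.transpose_mul, Matrix.mul_assoc, ← Matrix.mul_assoc Vᵀ, hVE]
        simp [Matrix.mul_assoc]
      rw [this, Matrix.trace_neg, frob]
    have b1 : (V - t • E) * Matrix.diagonal s = V * Matrix.diagonal s
        + (-t) • (E * Matrix.diagonal s) := by
      rw [Matrix.sub_mul, Matrix.smul_mul, neg_smul, sub_eq_add_neg]
    have b2 : ((V * Matrix.diagonal s)ᵀ * (E * Matrix.diagonal s)).trace
        = frob (E * Matrix.diagonal s) := by
      rw [frob, Matrix.transpose_mul, Matrix.transpose_mul, Matrix.mul_assoc,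
        ← Matrix.mul_assoc Vᵀ, hVE]
      simp [Matrix.mul_assoc]
    have c1 : Wy * (V - t • E) = (1 - t) • (Wy * V) := by
      rw [Matrix.mul_sub, Matrix.mul_smul, hWE, sub_smul, one_smul]
    have c2 : Wy * (V - t • E) * (V - t • E)ᵀ * Wyᵀ = (1 - t) ^ 2 • (Wy * V * Vᵀ * Wyᵀ) := by
      rw [Matrix.mul_assoc, ← Matrix.transpose_mul, c1, Matrix.transpose_smul, Matrix.smul_mul,
        Matrix.mul_smul, smul_smul, Matrix.transpose_mul, ← sq]
      simp [Matrix.mul_assoc]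
    have hld := log_det_shrink_le hγ hT (t := (1 - t) ^ 2) (by positivity) (by nlinarith)
    rw [a1, b1, c2, frob_add_smul, frob_add_smul, a2, b2] at ht
    have : 0 ≤ γ⁻¹ * (((1 - t) ^ 2 - 1) * (frob (E * Q) + frob (E * Matrix.diagonal s))) := by
      linarith
    exact nonneg_of_mul_nonneg_right this (inv_pos.2 hγ)
  have h1 := frob_nonneg (E * Q)
  have h2 : E * Matrix.diagonal s = 0 := frob_eq_zero.1 (by
    linarith [frob_nonneg (E * Matrix.diagonal s)])
  have h3 : E = 0 := by
    ext i j
    have := congrFun (congrFun h2 i) j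
    simpa [Matrix.mul_diagonal, hs j] using this
  rw [h3] at hE
  exact (sub_eq_zero.1 hE.symm)

/-- Once the columns of `V` are constrained to the kernel of `Wy`, only the linear VAE objective
remains to be minimized. -/
theorem vae_local_of_core_local {γ : ℝ} {B : Matrix n u ℝ} {Wy : Matrix m n ℝ}
    {V : Matrix n k ℝ} (hV : Wy * V = 0) {K : Matrix k n ℝ} {s : k → ℝ}
    (h : IsLocalMin (fun a : Matrix n e ℝ × Matrix k e ℝ × Matrix n k ℝ × Matrix k n ℝ × (k → ℝ) =>
      core γ B Wy a.1 a.2.1 a.2.2.1 a.2.2.2.1 a.2.2.2.2) (0, 0, V, K, s)) :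
    IsLocalMinOn (fun a : Matrix n k ℝ × Matrix k n ℝ × (k → ℝ) => vae γ B a.1 (a.2.1 * B) a.2.2)
      {a | Wy * a.1 = 0} (V, K, s) := by
  have hc : Continuous (fun a : Matrix n k ℝ × Matrix k n ℝ × (k → ℝ) =>
      ((0 : Matrix n e ℝ), (0 : Matrix k e ℝ), a)) := by fun_prop
  have := (hc.continuousAt (x := (V, K, s))).eventually h
  filter_upwards [mem_nhdsWithin_of_mem_nhds this, self_mem_nhdsWithin] with a ha haV
  simp only [core_centered_of_mul_eq_zero γ B hV,
    core_centered_of_mul_eq_zero γ B (show Wy * a.1 = 0 from haV)] at ha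
  linarith

end Local

end CycleCVAE

/-! ### Optimality conditions of the linear VAE -/

namespace CycleCVAE

set_option linter.unusedSectionVars false

variable {m n k u : Type*} [Fintype n] [Fintype k] [Fintype u]

/-- A factorization `V = B Z` reverses when `V` has at least the rank of `B`. -/
theorem exists_mul_eq_of_rank_le {n : Type*} [Finite n] {B : Matrix n u ℝ} {V : Matrix n k ℝ}
    {Z : Matrix u k ℝ} (hV : V = B * Z) (hr : B.rank ≤ V.rank) :
    ∃ Z' : Matrix k u ℝ, B = V * Z' := by
  classical
  have hle : LinearMap.range V.mulVecLin ≤ LinearMap.range B.mulVecLin := by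
    rw [hV, Matrix.mulVecLin_mul]; exact LinearMap.range_comp_le_range _ _
  have heq := Submodule.eq_of_le_of_finrank_le hle hr
  have hcol : ∀ j, ∃ z, V *ᵥ z = B.col j := fun j => by
    have : B.col j ∈ LinearMap.range V.mulVecLin := by
      rw [heq]; exact ⟨Pi.single j 1, by simp⟩
    exact this
  choose z hz using hcol
  refine ⟨Matrix.of fun i j => z j i, ?_⟩
  ext i j
  exact (congrFun (hz j) i).symm

variable [DecidableEq n] [DecidableEq k]

/-- The conditions that characterize the minima of the linear VAE objective `vae γ B V Q s`. With
`S = γ I + V Vᵀ`, the nonzero columns of `V` are orthogonal eigenvectors of `B Bᵀ` on which `B Bᵀ`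
and `S` agree, `B Bᵀ ≤ S`, `Q` is the ridge regression encoder, and `s i ^ 2` is the posterior
variance of the coordinate `i`. -/
structure IsOpt (γ : ℝ) (B : Matrix n u ℝ) (V : Matrix n k ℝ) (Q : Matrix k u ℝ) (s : k → ℝ) :
    Prop where
  range : ∃ Z : Matrix u k ℝ, V = B * Z
  orth : ∀ i j, i ≠ j → (Vᵀ * V) i j = 0
  encoder : Q = Vᵀ * ((γ • (1 : Matrix n n ℝ) + V * Vᵀ)⁻¹ * B)
  scale : ∀ i, s i ^ 2 * (1 + γ⁻¹ * (Vᵀ * V) i i) = 1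
  eig : B * Bᵀ * V = (γ • (1 : Matrix n n ℝ) + V * Vᵀ) * V
  psd : (γ • (1 : Matrix n n ℝ) + V * Vᵀ - B * Bᵀ).PosSemidef

/-- `P = (γ I + V Vᵀ)⁻¹ B` solves the equation `γ P + V Vᵀ P = B` around which `ridge` completes the
square. -/
theorem ridge_solution {u : Type*} {γ : ℝ} (hγ : 0 < γ) (B : Matrix n u ℝ) (V : Matrix n k ℝ) :
    γ • ((γ • (1 : Matrix n n ℝ) + V * Vᵀ)⁻¹ * B)
      + V * (Vᵀ * ((γ • (1 : Matrix n n ℝ) + V * Vᵀ)⁻¹ * B)) = B := by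
  have hS := posDef_smul_one_add hγ (posSemidef_mul_transpose V)
  have hu := (Matrix.isUnit_iff_isUnit_det _).1 hS.isUnit
  have : (γ • (1 : Matrix n n ℝ) + V * Vᵀ) * ((γ • (1 : Matrix n n ℝ) + V * Vᵀ)⁻¹ * B) = B := by
    rw [← Matrix.mul_assoc, Matrix.mul_nonsing_inv _ hu, Matrix.one_mul]
  rwa [Matrix.add_mul, Matrix.smul_mul, Matrix.one_mul, Matrix.mul_assoc V] at this

variable {γ : ℝ} {B : Matrix n u ℝ} {Wy : Matrix m n ℝ} {V : Matrix n k ℝ} {K : Matrix k n ℝ}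
  {s : k → ℝ}

/-- The objective is a convex quadratic function of `K B`, so moving `K` towards the ridge
regression encoder lowers it. -/
theorem vae_local_encoder (hγ : 0 < γ) (hV : Wy * V = 0)
    (h : IsLocalMinOn (fun a : Matrix n k ℝ × Matrix k n ℝ × (k → ℝ) =>
      vae γ B a.1 (a.2.1 * B) a.2.2) {a | Wy * a.1 = 0} (V, K, s)) :
    K * B = Vᵀ * ((γ • (1 : Matrix n n ℝ) + V * Vᵀ)⁻¹ * B) := by
  have hP := ridge_solution hγ B V
  obtain ⟨T, hT⟩ : ∃ T, T = (γ • (1 : Matrix n n ℝ) + V * Vᵀ)⁻¹ := ⟨_, rfl⟩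
  rw [← hT] at hP ⊢
  obtain ⟨E, hE⟩ : ∃ E, E = K * B - Vᵀ * (T * B) := ⟨_, rfl⟩
  have hp := isLocalMinOn_eventually_path h (g := fun t : ℝ => (V, K - t • (K - Vᵀ * T), s))
    (by fun_prop) (by simp) (Eventually.of_forall fun t => hV)
  have key : γ⁻¹ * frob (V * E) + frob E ≤ 0 := by
    apply nonpos_of_shrink
    filter_upwards [hp] with t ht _ _
    have e1 : K * B = Vᵀ * (T * B) + E := by rw [hE]; abel
    have e2 : (K - t • (K - Vᵀ * T)) * B = Vᵀ * (T * B) + (1 - t) • E := by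
      rw [Matrix.sub_mul, Matrix.smul_mul, Matrix.sub_mul, Matrix.mul_assoc, ← hE, e1, sub_smul,
        one_smul]
      abel
    simp only [vae_eq_sum, e2] at ht
    rw [e1, ridge hγ _ hP, ridge hγ _ hP, Matrix.mul_smul, frob_smul, frob_smul] at ht
    linarith
  have h1 := mul_nonneg (inv_pos.2 hγ).le (frob_nonneg (V * E))
  have h2 : E = 0 := frob_eq_zero.1 (by linarith [frob_nonneg E])
  rw [h2] at hE
  exact (sub_eq_zero.1 hE.symm)

/-- Criticality in `s i`. -/
theorem vae_local_scale (hV : Wy * V = 0) (hs : ∀ i, s i ≠ 0)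
    (h : IsLocalMinOn (fun a : Matrix n k ℝ × Matrix k n ℝ × (k → ℝ) =>
      vae γ B a.1 (a.2.1 * B) a.2.2) {a | Wy * a.1 = 0} (V, K, s)) (i : k) :
    s i ^ 2 * (1 + γ⁻¹ * (Vᵀ * V) i i) = 1 := by
  have hp := isLocalMinOn_eventually_path h
    (g := fun t : ℝ => (V, K, Function.update s i (s i * (1 + t))))
    (by
      refine ContinuousAt.prodMk continuousAt_const (ContinuousAt.prodMk continuousAt_const ?_)
      exact ContinuousAt.update continuousAt_const i (by fun_prop))
    (by simp) (Eventually.of_forall fun t => hV)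
  obtain ⟨a, ha⟩ : ∃ a, a = 1 + γ⁻¹ * (Vᵀ * V) i i := ⟨_, rfl⟩
  rw [← ha]
  have hmin : IsLocalMin (fun t : ℝ => s i ^ 2 * a * (1 + t) ^ 2 - 2 * Real.log (1 + t)) 0 := by
    filter_upwards [hp, lt_mem_nhds (show (-1 : ℝ) < 0 by norm_num)] with t ht h1
    simp only [vae_eq_sum] at ht
    rw [← Finset.add_sum_erase _ _ (Finset.mem_univ i),
      ← Finset.add_sum_erase Finset.univ (fun j => Function.update s i (s i * (1 + t)) j ^ 2 *
        (1 + γ⁻¹ * (Vᵀ * V) j j) - _) (Finset.mem_univ i)] at ht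
    have e : ∑ j ∈ Finset.univ.erase i, (Function.update s i (s i * (1 + t)) j ^ 2 *
        (1 + γ⁻¹ * (Vᵀ * V) j j) - Real.log (Function.update s i (s i * (1 + t)) j ^ 2))
        = ∑ j ∈ Finset.univ.erase i, (s j ^ 2 *
        (1 + γ⁻¹ * (Vᵀ * V) j j) - Real.log (s j ^ 2)) := by
      refine Finset.sum_congr rfl fun j hj => ?_
      rw [Function.update_of_ne (Finset.ne_of_mem_erase hj)]
    have hl : Real.log ((1 + t) ^ 2) = 2 * Real.log (1 + t) := by rw [Real.log_pow]; norm_num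
    rw [e, Function.update_self, ← ha, mul_pow, Real.log_mul (pow_ne_zero 2 (hs i))
      (pow_ne_zero 2 (by linarith)), hl] at ht
    simp only [add_zero, Real.log_one]
    linarith
  have hd : HasDerivAt (fun t : ℝ => s i ^ 2 * a * (1 + t) ^ 2 - 2 * Real.log (1 + t))
      (2 * (s i ^ 2 * a) - 2) 0 := by
    have h1 : HasDerivAt (fun t : ℝ => 1 + t) 1 0 := (hasDerivAt_id' (0 : ℝ)).const_add 1
    have := ((h1.fun_pow 2).const_mul (s i ^ 2 * a)).fun_sub
      ((h1.log (by norm_num)).const_mul 2)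
    exact this.congr_deriv (by norm_num; ring)
  have := hmin.hasDerivAt_eq_zero hd
  linarith

/-- Criticality in `V`. The gradient lies in the kernel of `Wy`, so it is an admissible direction.
-/
theorem vae_local_stationary (hγ : 0 < γ) (hV : Wy * V = 0) (hB : Wy * B = 0)
    (h : IsLocalMinOn (fun a : Matrix n k ℝ × Matrix k n ℝ × (k → ℝ) =>
      vae γ B a.1 (a.2.1 * B) a.2.2) {a | Wy * a.1 = 0} (V, K, s)) :
    (B - V * (K * B)) * (K * B)ᵀ = V * Matrix.diagonal (fun i => s i ^ 2) := by
  obtain ⟨Q, hQ⟩ : ∃ Q, Q = K * B := ⟨_, rfl⟩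
  rw [← hQ]
  obtain ⟨E, hE⟩ : ∃ E, E = (B - V * Q) * Qᵀ - V * Matrix.diagonal (fun i => s i ^ 2) := ⟨_, rfl⟩
  have hWE : Wy * E = 0 := by
    rw [hE]
    simp only [Matrix.mul_sub, Matrix.sub_mul, ← Matrix.mul_assoc, hB, hV]; simp
  have hp := isLocalMinOn_eventually_path h (g := fun t : ℝ => (V + t • E, K, s))
    (by fun_prop) (by simp) (Eventually.of_forall fun t => by
      simp [Matrix.mul_add, hV, hWE])
  have key := linear_coeff_eq_zero (β := -2 * γ⁻¹ * frob E)
      (δ := γ⁻¹ * (frob (E * Q) + frob (E * Matrix.diagonal s))) (by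
    filter_upwards [hp] with t ht
    simp only [vae, ← hQ] at ht
    have a1 : B - (V + t • E) * Q = (B - V * Q) + (-t) • (E * Q) := by
      rw [Matrix.add_mul, Matrix.smul_mul, neg_smul]; abel
    rw [a1, Matrix.add_mul, Matrix.smul_mul, frob_add_smul, frob_add_smul] at ht
    have a2 : ((V * Matrix.diagonal s)ᵀ * (E * Matrix.diagonal s)).trace
        - ((B - V * Q)ᵀ * (E * Q)).trace = - frob E := by
      have hEt : Eᵀ = Q * (B - V * Q)ᵀ - Matrix.diagonal s * (V * Matrix.diagonal s)ᵀ := by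
        have hdd : (Matrix.diagonal fun i => s i ^ 2) = Matrix.diagonal s * Matrix.diagonal s := by
          rw [Matrix.diagonal_mul_diagonal]; congr 1; ext; ring
        rw [hE, hdd, Matrix.transpose_sub, Matrix.transpose_mul _ Qᵀ, Matrix.transpose_transpose,
          ← Matrix.mul_assoc V, Matrix.transpose_mul _ (Matrix.diagonal s),
          Matrix.diagonal_transpose]
      rw [frob, hEt, Matrix.sub_mul, Matrix.trace_sub, Matrix.mul_assoc Q, Matrix.trace_mul_comm Q,
        Matrix.mul_assoc _ E, Matrix.mul_assoc (Matrix.diagonal s),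
        Matrix.trace_mul_comm (Matrix.diagonal s), Matrix.mul_assoc _ E]
      ring
    have a3 : γ⁻¹ * (((V * Matrix.diagonal s)ᵀ * (E * Matrix.diagonal s)).trace
        - ((B - V * Q)ᵀ * (E * Q)).trace) * t = γ⁻¹ * (- frob E) * t := by rw [a2]
    linarith)
  have h0 : frob E = 0 := by
    have : γ⁻¹ ≠ 0 := (inv_pos.2 hγ).ne'
    simpa [this] using key
  rw [frob_eq_zero.1 h0] at hE
  exact sub_eq_zero.1 hE.symm

/-- Second-order necessary condition for a quartic polynomial without odd terms. -/
theorem nonneg_of_sq_mul {a b : ℝ} (h : ∀ᶠ t in 𝓝 (0 : ℝ), 0 ≤ t ^ 2 * (a + b * t ^ 2)) :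
    0 ≤ a := by
  have hc : Tendsto (fun t : ℝ => a + b * t ^ 2) (𝓝[≠] 0) (𝓝 a) := by
    have : Continuous (fun t : ℝ => a + b * t ^ 2) := by fun_prop
    have := this.tendsto 0
    simp only [ne_eq, OfNat.ofNat_ne_zero, not_false_eq_true, zero_pow, mul_zero, add_zero] at this
    exact this.mono_left nhdsWithin_le_nhds
  refine ge_of_tendsto hc ?_
  filter_upwards [mem_nhdsWithin_of_mem_nhds h, self_mem_nhdsWithin] with t ht h0
  exact nonneg_of_mul_nonneg_right ht (by positivity [show t ≠ 0 from h0])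

/-- A vanishing column of `V` can be used to escape along any direction in which `B Bᵀ` exceeds
the noise level, so at a local minimum no such direction is left. -/
theorem vae_local_escape (hγ : 0 < γ) (hV : Wy * V = 0) (hs : ∀ i, s i ≠ 0)
    (h : IsLocalMinOn (fun a : Matrix n k ℝ × Matrix k n ℝ × (k → ℝ) =>
      vae γ B a.1 (a.2.1 * B) a.2.2) {a | Wy * a.1 = 0} (V, K, s)) {i : k}
    (hi : (Vᵀ * V) i i = 0) {w : Matrix n Unit ℝ} (hVw : Vᵀ * w = 0) (hWw : Wy * w = 0) :
    frob (wᵀ * B) ≤ γ * frob w := by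
  have hsi : s i ^ 2 = 1 := by simpa [hi] using vae_local_scale hV hs h i
  have hQ := vae_local_encoder hγ hV h
  obtain ⟨f, hf⟩ : ∃ f : Matrix Unit k ℝ, f = Matrix.single () i 1 := ⟨_, rfl⟩
  have hff : f * fᵀ = 1 := by ext; simp [hf]
  have hVf : V * fᵀ = 0 := by
    have hz : ∀ l, V l i = 0 := by
      have : ∑ l, V l i * V l i = 0 := by simpa [Matrix.mul_apply] using hi
      intro l
      have := (Finset.sum_eq_zero_iff_of_nonneg fun l _ => mul_self_nonneg (V l i)).1 this l
        (Finset.mem_univ l)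
      simpa using this
    ext l j
    simp [hf, Matrix.mul_apply, Matrix.single_apply, hz]
  have hfV : f * Vᵀ = 0 := by
    rw [← Matrix.transpose_transpose f, ← Matrix.transpose_mul, hVf, Matrix.transpose_zero]
  have hwV : wᵀ * V = 0 := by
    rw [← Matrix.transpose_transpose V, ← Matrix.transpose_mul, hVw, Matrix.transpose_zero]
  have hfQ : f * (K * B) = 0 := by rw [hQ, ← Matrix.mul_assoc, hfV, Matrix.zero_mul]
  have hp := isLocalMinOn_eventually_path h
    (g := fun t : ℝ => (V + t • (w * f), K + (t * γ⁻¹) • (fᵀ * wᵀ), s))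
    (by fun_prop) (by simp) (Eventually.of_forall fun t => by
      simp [Matrix.mul_add, hV, ← Matrix.mul_assoc, hWw])
  -- the column `i` of `V` moves along `t w` and the row `i` of `K` along `t γ⁻¹ wᵀ`
  have key := nonneg_of_sq_mul (a := γ⁻¹ * frob w - γ⁻¹ ^ 2 * frob (wᵀ * B))
      (b := γ⁻¹ ^ 3 * frob (w * (wᵀ * B))) (by
    filter_upwards [hp] with t ht
    simp only [vae] at ht
    have a0 : (K + (t * γ⁻¹) • (fᵀ * wᵀ)) * B = K * B + (t * γ⁻¹) • (fᵀ * (wᵀ * B)) := by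
      rw [Matrix.add_mul, Matrix.smul_mul, Matrix.mul_assoc]
    have a1 : B - (V + t • (w * f)) * ((K + (t * γ⁻¹) • (fᵀ * wᵀ)) * B)
        = (B - V * (K * B)) + (-(t ^ 2 * γ⁻¹)) • (w * (wᵀ * B)) := by
      rw [a0]
      have e1 : V * (fᵀ * (wᵀ * B)) = 0 := by rw [← Matrix.mul_assoc, hVf, Matrix.zero_mul]
      have e2 : w * f * (K * B) = 0 := by rw [Matrix.mul_assoc, hfQ, Matrix.mul_zero]
      have e3 : w * f * (fᵀ * (wᵀ * B)) = w * (wᵀ * B) := by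
        rw [Matrix.mul_assoc, ← Matrix.mul_assoc f, hff, Matrix.one_mul]
      rw [Matrix.add_mul, Matrix.mul_add, Matrix.mul_add, Matrix.mul_smul, e1, Matrix.smul_mul,
        e2, Matrix.smul_mul, Matrix.mul_smul, e3, smul_zero, smul_zero, neg_smul, smul_smul]
      have : t * (t * γ⁻¹) = t ^ 2 * γ⁻¹ := by ring
      rw [this]; abel
    have a2 : ((B - V * (K * B))ᵀ * (w * (wᵀ * B))).trace = frob (wᵀ * B) := by
      rw [Matrix.transpose_sub, Matrix.transpose_mul V, Matrix.sub_mul, Matrix.mul_assoc _ Vᵀ,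
        ← Matrix.mul_assoc Vᵀ, hVw, frob]
      simp [Matrix.transpose_mul, Matrix.mul_assoc]
    have b1 : (V + t • (w * f)) * Matrix.diagonal s
        = V * Matrix.diagonal s + t • (w * f * Matrix.diagonal s) := by
      rw [Matrix.add_mul, Matrix.smul_mul]
    have b2 : ((V * Matrix.diagonal s)ᵀ * (w * f * Matrix.diagonal s)).trace = 0 := by
      rw [Matrix.transpose_mul, Matrix.mul_assoc, ← Matrix.mul_assoc Vᵀ, ← Matrix.mul_assoc Vᵀ,
        hVw]
      simp
    have b3 : frob (w * f * Matrix.diagonal s) = frob w := by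
      have : f * Matrix.diagonal s = s i • f := by
        ext a j
        by_cases hj : i = j
        · subst hj; simp [hf, Matrix.mul_diagonal]
        · simp [hf, Matrix.mul_diagonal, hj]
      rw [Matrix.mul_assoc, this, Matrix.mul_smul, frob_smul, hsi, one_mul, ← frob_transpose,
        frob, Matrix.transpose_transpose, Matrix.transpose_mul, Matrix.mul_assoc,
        ← Matrix.mul_assoc f, hff, Matrix.one_mul, ← frob_transpose w, frob,
        Matrix.transpose_transpose]
    have c2 : ((K * B)ᵀ * (fᵀ * (wᵀ * B))).trace = 0 := by
      rw [← Matrix.mul_assoc, ← Matrix.transpose_mul, hfQ]; simp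
    have c3 : frob (fᵀ * (wᵀ * B)) = frob (wᵀ * B) := by
      rw [frob, Matrix.transpose_mul, Matrix.transpose_transpose, Matrix.mul_assoc,
        ← Matrix.mul_assoc f, hff, Matrix.one_mul, frob]
    rw [a1, b1, a0, frob_add_smul, frob_add_smul, frob_add_smul, a2, b2, b3, c2, c3] at ht
    linarith)
  have : γ⁻¹ ^ 2 * frob (wᵀ * B) ≤ γ⁻¹ ^ 2 * (γ * frob w) := by
    have e : γ⁻¹ ^ 2 * (γ * frob w) = γ⁻¹ * frob w := by field_simp
    linarith
  exact le_of_mul_le_mul_left this (by positivity)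

end CycleCVAE

/-! ### Orthogonality of the columns by plane rotations -/

namespace CycleCVAE

set_option linter.unusedSectionVars false

variable {m n k u : Type*} [Fintype n] [Fintype k] [Fintype u] [DecidableEq n] [DecidableEq k]

/-- The rotation by the angle `t` in the plane of the coordinates `i` and `j`. -/
noncomputable def planeRot (i j : k) (t : ℝ) : Matrix k k ℝ :=
  1 + (Real.cos t - 1) • (Matrix.single i i 1 + Matrix.single j j 1)
    + Real.sin t • (Matrix.single i j 1 - Matrix.single j i 1)

theorem planeRot_mul_transpose {i j : k} (hij : i ≠ j) (t : ℝ) :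
    planeRot i j t * (planeRot i j t)ᵀ = 1 := by
  -- `P` is the projection to the plane and `J` its rotation by a right angle
  obtain ⟨P, hP⟩ : ∃ P : Matrix k k ℝ, P = Matrix.single i i 1 + Matrix.single j j 1 := ⟨_, rfl⟩
  obtain ⟨J, hJ⟩ : ∃ J : Matrix k k ℝ, J = Matrix.single i j 1 - Matrix.single j i 1 := ⟨_, rfl⟩
  have hPt : Pᵀ = P := by simp [hP]
  have hJt : Jᵀ = -J := by simp [hJ]
  have hPP : P * P = P := by
    simp [hP, Matrix.add_mul, Matrix.mul_add, hij, hij.symm]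
  have hPJ : P * J = J := by
    simp [hP, hJ, Matrix.add_mul, Matrix.mul_sub, hij, hij.symm]
  have hJP : J * P = J := by
    simp [hP, hJ, Matrix.mul_add, Matrix.sub_mul, hij, hij.symm]; abel
  have hJJ : J * J = -P := by
    simp [hP, hJ, Matrix.mul_sub, Matrix.sub_mul, hij, hij.symm]; abel
  rw [planeRot, ← hP, ← hJ]
  simp only [Matrix.transpose_add, Matrix.transpose_smul, Matrix.transpose_one, hPt, hJt,
    Matrix.add_mul, Matrix.mul_add, Matrix.smul_mul, Matrix.mul_smul, Matrix.one_mul,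
    Matrix.mul_one, Matrix.mul_neg, hPP, hPJ, hJP, hJJ, smul_neg]
  have h := Real.sin_sq_add_cos_sq t
  have : (Real.cos t - 1) + (Real.cos t - 1) + (Real.cos t - 1) * (Real.cos t - 1)
      + Real.sin t * Real.sin t = 0 := by nlinarith
  calc _ = 1 + ((Real.cos t - 1) + (Real.cos t - 1) + (Real.cos t - 1) * (Real.cos t - 1)
        + Real.sin t * Real.sin t) • P := by module
    _ = 1 := by rw [this, zero_smul, add_zero]

theorem mul_planeRot_left {i j : k} (hij : i ≠ j) (V : Matrix n k ℝ) (t : ℝ) (l : n) :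
    (V * planeRot i j t) l i = Real.cos t * V l i - Real.sin t * V l j := by
  simp [planeRot, Matrix.mul_add, Matrix.mul_sub, hij]
  ring

theorem mul_planeRot_right {i j : k} (hij : i ≠ j) (V : Matrix n k ℝ) (t : ℝ) (l : n) :
    (V * planeRot i j t) l j = Real.sin t * V l i + Real.cos t * V l j := by
  simp [planeRot, Matrix.mul_add, Matrix.mul_sub, hij.symm]
  ring

theorem mul_planeRot_of_ne {i j a : k} (hi : a ≠ i) (hj : a ≠ j) (V : Matrix n k ℝ) (t : ℝ)
    (l : n) : (V * planeRot i j t) l a = V l a := by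
  simp [planeRot, Matrix.mul_add, Matrix.mul_sub, hi, hj]

theorem gram_planeRot_left {i j : k} (hij : i ≠ j) (V : Matrix n k ℝ) (t : ℝ) :
    ((V * planeRot i j t)ᵀ * (V * planeRot i j t)) i i
      = Real.cos t ^ 2 * (Vᵀ * V) i i - 2 * Real.sin t * Real.cos t * (Vᵀ * V) i j
        + Real.sin t ^ 2 * (Vᵀ * V) j j := by
  rw [Matrix.mul_apply]
  simp only [Matrix.transpose_apply, mul_planeRot_left hij]
  simp only [Matrix.mul_apply, Matrix.transpose_apply, Finset.mul_sum, ← Finset.sum_add_distrib,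
    ← Finset.sum_sub_distrib]
  exact Finset.sum_congr rfl fun l _ => by ring

theorem gram_planeRot_right {i j : k} (hij : i ≠ j) (V : Matrix n k ℝ) (t : ℝ) :
    ((V * planeRot i j t)ᵀ * (V * planeRot i j t)) j j
      = Real.sin t ^ 2 * (Vᵀ * V) i i + 2 * Real.sin t * Real.cos t * (Vᵀ * V) i j
        + Real.cos t ^ 2 * (Vᵀ * V) j j := by
  rw [Matrix.mul_apply]
  simp only [Matrix.transpose_apply, mul_planeRot_right hij]
  simp only [Matrix.mul_apply, Matrix.transpose_apply, Finset.mul_sum, ← Finset.sum_add_distrib]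
  exact Finset.sum_congr rfl fun l _ => by ring

theorem gram_planeRot_of_ne {i j a : k} (hi : a ≠ i) (hj : a ≠ j) (V : Matrix n k ℝ) (t : ℝ) :
    ((V * planeRot i j t)ᵀ * (V * planeRot i j t)) a a = (Vᵀ * V) a a := by
  rw [Matrix.mul_apply, Matrix.mul_apply]
  simp only [Matrix.transpose_apply, mul_planeRot_of_ne hi hj]

/-- A plane rotation of the symmetric matrix with diagonal `a, b` and off-diagonal entry `g ≠ 0`
can always lower the product of the diagonal entries. -/
theorem offdiag_eq_zero_of_local {a b g : ℝ}
    (h : ∀ᶠ t in 𝓝 (0 : ℝ), a * b ≤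
      (Real.cos t ^ 2 * a - 2 * Real.sin t * Real.cos t * g + Real.sin t ^ 2 * b) *
      (Real.sin t ^ 2 * a + 2 * Real.sin t * Real.cos t * g + Real.cos t ^ 2 * b)) : g = 0 := by
  by_contra hg
  have hmin : IsLocalMin (fun t : ℝ =>
      (Real.cos t ^ 2 * a - 2 * Real.sin t * Real.cos t * g + Real.sin t ^ 2 * b) *
      (Real.sin t ^ 2 * a + 2 * Real.sin t * Real.cos t * g + Real.cos t ^ 2 * b)) 0 := by
    filter_upwards [h] with t ht
    simpa using ht
  have hs := Real.hasDerivAt_sin 0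
  have hc := Real.hasDerivAt_cos 0
  have hd := (((((hc.fun_pow 2).mul_const a).fun_sub
    (((hs.const_mul 2).fun_mul hc).mul_const g)).fun_add
    ((hs.fun_pow 2).mul_const b)).fun_mul ((((hs.fun_pow 2).mul_const a).fun_add
      (((hs.const_mul 2).fun_mul hc).mul_const g)).fun_add ((hc.fun_pow 2).mul_const b)))
  have h0 := hmin.hasDerivAt_eq_zero hd
  norm_num at h0
  -- the first derivative forces `a = b`; then the product is `a² - (2 sin t cos t g)²`
  have hab : a = b := by
    have : g * (a - b) = 0 := by linarith
    have := (mul_eq_zero.1 this).resolve_left hg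
    linarith
  subst hab
  obtain ⟨ε, hε, hh⟩ := Metric.eventually_nhds_iff.1 h
  have h1 : 0 < min (ε / 2) 1 := by positivity
  have h2 := hh (y := min (ε / 2) 1) (by
    rw [Real.dist_eq, sub_zero, abs_of_pos h1]
    linarith [min_le_left (ε / 2) 1])
  set t := min (ε / 2) 1
  have ht1 : t ≤ 1 := min_le_right _ _
  have hsin : 0 < Real.sin t := Real.sin_pos_of_pos_of_lt_pi h1 (by linarith [Real.pi_gt_three])
  have hcos : 0 < Real.cos t := Real.cos_pos_of_le_one (by rw [abs_of_pos h1]; exact ht1)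
  have hsc := Real.sin_sq_add_cos_sq t
  have e1 : Real.cos t ^ 2 * a - 2 * Real.sin t * Real.cos t * g + Real.sin t ^ 2 * a
      = a - 2 * Real.sin t * Real.cos t * g := by linear_combination a * hsc
  have e2 : Real.sin t ^ 2 * a + 2 * Real.sin t * Real.cos t * g + Real.cos t ^ 2 * a
      = a + 2 * Real.sin t * Real.cos t * g := by linear_combination a * hsc
  rw [e1, e2] at h2
  have h3 : 0 < (2 * Real.sin t * Real.cos t * g) ^ 2 := by positivity
  nlinarith

variable {γ : ℝ} {B : Matrix n u ℝ} {Wy : Matrix m n ℝ} {V : Matrix n k ℝ} {K : Matrix k n ℝ}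
  {s : k → ℝ}

/-- Rotating two columns of `V`, together with the corresponding rows of the encoder, changes only
the term `∑ log (1 + |v|² / γ)`, which forces the columns to be orthogonal. -/
theorem vae_local_orth (hγ : 0 < γ) (hV : Wy * V = 0)
    (h : IsLocalMinOn (fun a : Matrix n k ℝ × Matrix k n ℝ × (k → ℝ) =>
      vae γ B a.1 (a.2.1 * B) a.2.2) {a | Wy * a.1 = 0} (V, K, s)) (hs : ∀ i, s i ≠ 0)
    {i j : k} (hij : i ≠ j) : (Vᵀ * V) i j = 0 := by
  obtain ⟨a, ha⟩ : ∃ a : ℝ → k → ℝ, a = fun t l =>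
    1 + γ⁻¹ * ((V * planeRot i j t)ᵀ * (V * planeRot i j t)) l l := ⟨_, rfl⟩
  have hpos : ∀ t l, 0 < a t l := fun t l => by
    rw [ha]
    have := mul_nonneg (inv_pos.2 hγ).le (gram_diag_nonneg (V * planeRot i j t) l)
    simp only
    linarith
  have hR0 : planeRot i j 0 = 1 := by simp [planeRot]
  have hRc : Continuous (planeRot i j) := by unfold planeRot; fun_prop
  have hac : ∀ l, Continuous fun t => a t l := fun l => by
    rw [ha]
    simp only [Matrix.mul_apply, Matrix.transpose_apply]
    have : ∀ p q, Continuous fun t => planeRot i j t p q := fun p q => by fun_prop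
    fun_prop
  -- along the rotation the encoder variances are kept at their optimal values `1 / a t l`
  have hp := isLocalMinOn_eventually_path h
    (g := fun t : ℝ => (V * planeRot i j t, (planeRot i j t)ᵀ * K,
      fun l => s l * Real.sqrt (a 0 l / a t l)))
    (by
      refine ContinuousAt.prodMk (by fun_prop) (ContinuousAt.prodMk (by fun_prop) ?_)
      refine continuousAt_pi.2 fun l => continuousAt_const.mul ?_
      exact (continuousAt_const.div (hac l).continuousAt (hpos 0 l).ne').sqrt)
    (by
      have : ∀ l, Real.sqrt (a 0 l / a 0 l) = 1 := fun l => by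
        rw [div_self (hpos 0 l).ne', Real.sqrt_one]
      simp [hR0, this]) (Eventually.of_forall fun t => by
      simp [← Matrix.mul_assoc, hV])
  have key : (γ⁻¹ * (Vᵀ * V) i j) = 0 := by
    apply offdiag_eq_zero_of_local (a := a 0 i) (b := a 0 j)
    filter_upwards [hp] with t ht
    have hRR := planeRot_mul_transpose hij t
    have e1 : V * planeRot i j t * ((planeRot i j t)ᵀ * K * B) = V * (K * B) := by
      rw [Matrix.mul_assoc, ← Matrix.mul_assoc (planeRot i j t),
        ← Matrix.mul_assoc (planeRot i j t), hRR, Matrix.one_mul]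
    have e2 : frob ((planeRot i j t)ᵀ * K * B) = frob (K * B) := by
      rw [Matrix.mul_assoc, frob, Matrix.transpose_mul, Matrix.transpose_transpose,
        Matrix.mul_assoc, ← Matrix.mul_assoc (planeRot i j t), hRR, Matrix.one_mul, frob]
    simp only [vae_eq_sum] at ht
    rw [e1, e2] at ht
    have ha0 : ∀ l, 1 + γ⁻¹ * (Vᵀ * V) l l = a 0 l := fun l => by simp [ha, hR0]
    have hat : ∀ l, 1 + γ⁻¹ * ((V * planeRot i j t)ᵀ * (V * planeRot i j t)) l l = a t l :=
      fun l => by rw [ha]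
    simp only [ha0, hat] at ht
    have e3 : ∑ l, ((s l * Real.sqrt (a 0 l / a t l)) ^ 2 * a t l
        - Real.log ((s l * Real.sqrt (a 0 l / a t l)) ^ 2))
        = ∑ l, (s l ^ 2 * a 0 l - Real.log (s l ^ 2))
          + ∑ l, (Real.log (a t l) - Real.log (a 0 l)) := by
      rw [← Finset.sum_add_distrib]
      refine Finset.sum_congr rfl fun l _ => ?_
      have p0 := hpos 0 l
      have pt := hpos t l
      rw [mul_pow, Real.sq_sqrt (div_pos p0 pt).le, Real.log_mul (pow_ne_zero 2 (hs l))
        (div_pos p0 pt).ne', Real.log_div p0.ne' pt.ne']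
      field_simp
      ring
    have e4 : ∑ l, (Real.log (a t l) - Real.log (a 0 l))
        = Real.log (a t i) - Real.log (a 0 i) + (Real.log (a t j) - Real.log (a 0 j)) :=
      Finset.sum_eq_add_of_mem i j (Finset.mem_univ _) (Finset.mem_univ _) hij (by
        rintro l - ⟨hli, hlj⟩
        have : a t l = a 0 l := by
          rw [ha]; simp only [gram_planeRot_of_ne hli hlj]
        rw [this, sub_self])
    rw [e3, e4] at ht
    have hlog : Real.log (a 0 i * a 0 j) ≤ Real.log (a t i * a t j) := by
      rw [Real.log_mul (hpos _ _).ne' (hpos _ _).ne', Real.log_mul (hpos _ _).ne' (hpos _ _).ne']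
      linarith
    have hfin := (Real.log_le_log_iff (mul_pos (hpos 0 i) (hpos 0 j))
      (mul_pos (hpos t i) (hpos t j))).1 hlog
    have hsc := Real.sin_sq_add_cos_sq t
    have f1 : a t i = Real.cos t ^ 2 * a 0 i - 2 * Real.sin t * Real.cos t * (γ⁻¹ * (Vᵀ * V) i j)
        + Real.sin t ^ 2 * a 0 j := by
      rw [← ha0, ← ha0, ← hat, gram_planeRot_left hij]
      linear_combination -hsc
    have f2 : a t j = Real.sin t ^ 2 * a 0 i + 2 * Real.sin t * Real.cos t * (γ⁻¹ * (Vᵀ * V) i j)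
        + Real.cos t ^ 2 * a 0 j := by
      rw [← ha0, ← ha0, ← hat, gram_planeRot_right hij]
      linear_combination -hsc
    rwa [f1, f2] at hfin
  exact (mul_eq_zero.1 key).resolve_left (inv_pos.2 hγ).ne'

/-- The Gram matrix of orthogonal columns is diagonal. -/
theorem mul_gram_of_orth {V : Matrix n k ℝ} (ho : ∀ i j, i ≠ j → (Vᵀ * V) i j = 0) :
    Vᵀ * V = Matrix.diagonal fun i => (Vᵀ * V) i i := by
  ext i j
  by_cases hij : i = j
  · subst hij; simp
  · rw [ho i j hij, Matrix.diagonal_apply_ne _ hij]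

/-- Orthogonal columns are eigenvectors of `γ I + V Vᵀ`, the `i`-th one with eigenvalue
`γ + |v i|² = γ / s i ^ 2`. -/
theorem shifted_mul_of_orth (hγ : 0 < γ) (ho : ∀ i j, i ≠ j → (Vᵀ * V) i j = 0)
    (hsc : ∀ i, s i ^ 2 * (1 + γ⁻¹ * (Vᵀ * V) i i) = 1) :
    (γ • (1 : Matrix n n ℝ) + V * Vᵀ) * V * Matrix.diagonal (fun i => s i ^ 2) = γ • V := by
  have h1 : (γ • (1 : Matrix n n ℝ) + V * Vᵀ) * V
      = V * (γ • (1 : Matrix k k ℝ) + Matrix.diagonal fun i => (Vᵀ * V) i i) := by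
    rw [← mul_gram_of_orth ho, Matrix.add_mul, Matrix.mul_add]
    simp [Matrix.mul_assoc]
  have h2 : (γ • (1 : Matrix k k ℝ) + Matrix.diagonal fun i => (Vᵀ * V) i i)
      * Matrix.diagonal (fun i => s i ^ 2) = γ • 1 := by
    rw [Matrix.smul_one_eq_diagonal, Matrix.diagonal_add, Matrix.diagonal_mul_diagonal]
    congr 1; ext i
    have := hsc i
    field_simp at this
    change (γ + (Vᵀ * V) i i) * s i ^ 2 = γ
    linarith
  rw [h1, Matrix.mul_assoc, h2, Matrix.mul_smul, Matrix.mul_one]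

/-- A local minimum of the constrained linear VAE problem satisfies all the optimality conditions.
The bound `B Bᵀ ≤ S` uses `vae_local_escape` if `V` has a vanishing column; otherwise `V` has rank
at least `rank B`, and there is nothing left outside its column space. -/
theorem isOpt_of_vae_local (hγ : 0 < γ) (hB : Wy * B = 0) (hr : B.rank ≤ Fintype.card k)
    (hR : ∃ Z : Matrix u k ℝ, V = B * Z) (hs : ∀ i, s i ≠ 0)
    (h : IsLocalMinOn (fun a : Matrix n k ℝ × Matrix k n ℝ × (k → ℝ) =>
      vae γ B a.1 (a.2.1 * B) a.2.2) {a | Wy * a.1 = 0} (V, K, s)) :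
    IsOpt γ B V (K * B) s := by
  obtain ⟨Z, hZ⟩ := hR
  have hV : Wy * V = 0 := by rw [hZ, ← Matrix.mul_assoc, hB, Matrix.zero_mul]
  have ho : ∀ i j, i ≠ j → (Vᵀ * V) i j = 0 := fun i j => vae_local_orth hγ hV h hs
  have hsc := vae_local_scale hV hs h
  have henc := vae_local_encoder hγ hV h
  have hst := vae_local_stationary hγ hV hB h
  have hSV := shifted_mul_of_orth hγ ho hsc
  have hS := posDef_smul_one_add hγ (posSemidef_mul_transpose V)
  have hu := (Matrix.isUnit_iff_isUnit_det _).1 hS.isUnit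
  have heig : B * Bᵀ * V = (γ • (1 : Matrix n n ℝ) + V * Vᵀ) * V := by
    have hP := ridge_solution hγ B V
    obtain ⟨S, hSd⟩ : ∃ S, S = γ • (1 : Matrix n n ℝ) + V * Vᵀ := ⟨_, rfl⟩
    rw [← hSd] at hSV hS hu henc hP ⊢
    have hSt : S⁻¹ᵀ = S⁻¹ := hS.inv.1
    obtain ⟨D, hD⟩ : ∃ D, D = Matrix.diagonal (fun i => s i ^ 2) := ⟨_, rfl⟩
    rw [← hD] at hSV hst
    have hSinvV : S⁻¹ * V = γ⁻¹ • (V * D) := by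
      have : V * D = γ • (S⁻¹ * V) := by
        rw [← Matrix.mul_smul, ← hSV, ← Matrix.mul_assoc, ← Matrix.mul_assoc,
          Matrix.nonsing_inv_mul _ hu, Matrix.one_mul]
      rw [this, smul_smul, inv_mul_cancel₀ hγ.ne', one_smul]
    have hres : B - V * (K * B) = γ • (S⁻¹ * B) := by
      rw [henc]; nth_rw 1 [← hP]; abel
    have e1 : B * Bᵀ * (S⁻¹ * V) = V := by
      have h1 : γ • (S⁻¹ * (B * Bᵀ * (S⁻¹ * V))) = V * D := by
        rw [← hst, hres, henc]
        simp only [Matrix.transpose_mul, Matrix.transpose_transpose, hSt, Matrix.smul_mul,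
          Matrix.mul_assoc]
      have h2 : γ • (B * Bᵀ * (S⁻¹ * V)) = γ • V := by
        rw [← hSV, Matrix.mul_assoc S, ← h1, Matrix.mul_smul, ← Matrix.mul_assoc S,
          Matrix.mul_nonsing_inv _ hu, Matrix.one_mul]
      exact smul_right_injective _ hγ.ne' h2
    -- multiply by the inverse of the diagonal matrix of encoder variances
    have hDD : D * Matrix.diagonal (fun i => 1 + γ⁻¹ * (Vᵀ * V) i i) = 1 := by
      rw [hD, Matrix.diagonal_mul_diagonal, ← Matrix.diagonal_one]
      congr 1; ext i; exact hsc i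
    have h3 : B * Bᵀ * V * D = S * V * D := by
      rw [hSV]
      rw [hSinvV, Matrix.mul_smul] at e1
      conv_rhs => rw [← e1]
      rw [smul_smul, mul_inv_cancel₀ hγ.ne', one_smul, Matrix.mul_assoc]
    have h4 := congrArg (· * Matrix.diagonal (fun i => 1 + γ⁻¹ * (Vᵀ * V) i i)) h3
    simpa [Matrix.mul_assoc, hDD] using h4
  refine ⟨⟨Z, hZ⟩, ho, henc, hsc, heig, ?_⟩
  refine Matrix.PosSemidef.of_dotProduct_mulVec_nonneg ?_ ?_
  · have h1 : (γ • (1 : Matrix n n ℝ) + V * Vᵀ).IsHermitian := hS.1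
    exact h1.sub (posSemidef_mul_transpose B).1
  intro x
  obtain ⟨M, hM⟩ : ∃ M, M = γ • (1 : Matrix n n ℝ) + V * Vᵀ - B * Bᵀ := ⟨_, rfl⟩
  have hMV : M * V = 0 := by rw [hM, Matrix.sub_mul, heig, sub_self]
  have hMt : Mᵀ = M := by rw [hM]; simp [Matrix.transpose_mul]
  have hVM : Vᵀ * M = 0 := by rw [← hMt, ← Matrix.transpose_mul, hMV, Matrix.transpose_zero]
  rw [← hM]
  obtain ⟨X, hX⟩ : ∃ X : Matrix n Unit ℝ, X = Matrix.replicateCol Unit x := ⟨_, rfl⟩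
  have hxX : star x ⬝ᵥ M *ᵥ x = (Xᵀ * (M * X)).trace := by
    simp [hX, Matrix.trace, Matrix.mul_apply, dotProduct, Matrix.mulVec]
  rw [hxX]
  -- split off the component of `X` in the column space of `V`, which `M` annihilates
  obtain ⟨Y, hY⟩ := exists_normal_eq V X
  obtain ⟨w, hw⟩ : ∃ w, w = X - V * Y := ⟨_, rfl⟩
  have hVw : Vᵀ * w = 0 := by rw [hw, Matrix.mul_sub, ← Matrix.mul_assoc, hY, sub_self]
  have hXw : X = w + V * Y := by rw [hw]; abel
  have hwV : wᵀ * V = 0 := by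
    rw [← Matrix.transpose_transpose V, ← Matrix.transpose_mul, hVw, Matrix.transpose_zero]
  have e1 : (Xᵀ * (M * X)).trace = γ * frob w - frob (wᵀ * B) := by
    have : M * X = M * w := by
      rw [hXw, Matrix.mul_add, ← Matrix.mul_assoc, hMV]; simp
    rw [this, hXw, Matrix.transpose_add, Matrix.add_mul, Matrix.transpose_mul, Matrix.mul_assoc Yᵀ,
      ← Matrix.mul_assoc Vᵀ, hVM, hM, ← frob_transpose (wᵀ * B), frob, frob]
    simp [Matrix.sub_mul, Matrix.add_mul, Matrix.mul_sub, Matrix.mul_assoc, hVw,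
      Matrix.transpose_mul]
  rw [e1, sub_nonneg]
  -- the component `r` of `w` orthogonal to the columns of `B` does not contribute to `wᵀ B`
  obtain ⟨Y', hY'⟩ := exists_normal_eq B w
  obtain ⟨v, hv⟩ : ∃ v, v = B * Y' := ⟨_, rfl⟩
  obtain ⟨r, hrd⟩ : ∃ r, r = w - v := ⟨_, rfl⟩
  have hwr : w = v + r := by rw [hrd]; abel
  have hBr : Bᵀ * r = 0 := by
    rw [hrd, hv, Matrix.mul_sub, ← Matrix.mul_assoc, hY', sub_self]
  have hrB : rᵀ * B = 0 := by
    rw [← Matrix.transpose_transpose B, ← Matrix.transpose_mul, hBr, Matrix.transpose_zero]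
  have hfw : frob w = frob v + frob r := by
    rw [hwr, frob_add, hv, Matrix.transpose_mul, Matrix.mul_assoc, hBr]; simp
  have hwB : wᵀ * B = vᵀ * B := by rw [hwr, Matrix.transpose_add, Matrix.add_mul, hrB, add_zero]
  have hVv : Vᵀ * v = 0 := by
    have h1 : Vᵀ * r = 0 := by rw [hZ, Matrix.transpose_mul, Matrix.mul_assoc, hBr, Matrix.mul_zero]
    rw [hwr, Matrix.mul_add, h1, add_zero] at hVw
    exact hVw
  have hWv : Wy * v = 0 := by rw [hv, ← Matrix.mul_assoc, hB, Matrix.zero_mul]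
  by_cases hz : ∃ i, (Vᵀ * V) i i = 0
  · obtain ⟨i, hi⟩ := hz
    have := vae_local_escape hγ hV hs h hi hVv hWv
    rw [hwB, hfw]
    have := mul_nonneg hγ.le (frob_nonneg r)
    linarith
  · push Not at hz
    have hrank : V.rank = Fintype.card k := by
      rw [← Matrix.rank_transpose_mul_self, mul_gram_of_orth ho, Matrix.rank_diagonal]
      exact Fintype.card_of_subtype Finset.univ (by simpa using hz)
    obtain ⟨Z', hZ'⟩ := exists_mul_eq_of_rank_le hZ (hr.trans hrank.ge)
    have : wᵀ * B = 0 := by rw [hZ', ← Matrix.mul_assoc, hwV, Matrix.zero_mul]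
    rw [this, frob_zero]
    exact mul_nonneg hγ.le (frob_nonneg w)

end CycleCVAE

/-! ### Weak duality and the optimal solutions -/

namespace CycleCVAE

set_option linter.unusedSectionVars false

variable {m n k u : Type*} [Fintype n] [Fintype k] [Fintype u] [DecidableEq n] [DecidableEq k]
variable {γ : ℝ} {B : Matrix n u ℝ} {V : Matrix n k ℝ} {Q : Matrix k u ℝ} {s : k → ℝ}

/-- The matrix determinant lemma for `γ I + V Vᵀ`. -/
theorem shifted_det (hγ : 0 < γ) (V : Matrix n k ℝ) :
    Real.log (γ • (1 : Matrix n n ℝ) + V * Vᵀ).det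
      = Fintype.card n * Real.log γ + Real.log (1 + γ⁻¹ • (Vᵀ * V)).det := by
  have h1 : γ • (1 : Matrix n n ℝ) + V * Vᵀ = γ • (1 + (γ⁻¹ • V) * Vᵀ) := by
    rw [smul_add, Matrix.smul_mul, smul_smul, mul_inv_cancel₀ hγ.ne', one_smul]
  have h2 : (1 + γ⁻¹ • (Vᵀ * V)).PosDef := by
    have := (posSemidef_mul_transpose Vᵀ).smul (inv_pos.2 hγ).le
    rw [Matrix.transpose_transpose] at this
    exact Matrix.PosDef.one.add_posSemidef this
  rw [h1, Matrix.det_smul, Matrix.det_one_add_mul_comm, Matrix.mul_smul,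
    Real.log_mul (pow_ne_zero _ hγ.ne') h2.det_pos.ne', Real.log_pow]

theorem shifted_det_le_sum (hγ : 0 < γ) (V : Matrix n k ℝ) :
    Real.log (γ • (1 : Matrix n n ℝ) + V * Vᵀ).det
      ≤ Fintype.card n * Real.log γ + ∑ i, Real.log (1 + γ⁻¹ * (Vᵀ * V) i i) := by
  rw [shifted_det hγ]
  have h2 : (1 + γ⁻¹ • (Vᵀ * V)).PosDef := by
    have := (posSemidef_mul_transpose Vᵀ).smul (inv_pos.2 hγ).le
    rw [Matrix.transpose_transpose] at this
    exact Matrix.PosDef.one.add_posSemidef this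
  have := log_det_le_sum_diag h2
  simpa using this

theorem shifted_det_of_orth (hγ : 0 < γ) (ho : ∀ i j, i ≠ j → (Vᵀ * V) i j = 0) :
    Real.log (γ • (1 : Matrix n n ℝ) + V * Vᵀ).det
      = Fintype.card n * Real.log γ + ∑ i, Real.log (1 + γ⁻¹ * (Vᵀ * V) i i) := by
  have hd : (1 + γ⁻¹ • (Vᵀ * V)) = Matrix.diagonal fun i => 1 + γ⁻¹ * (Vᵀ * V) i i := by
    rw [mul_gram_of_orth ho, ← Matrix.diagonal_one, ← Matrix.diagonal_smul, Matrix.diagonal_add]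
    simp
  rw [shifted_det hγ, hd, Matrix.det_diagonal, Real.log_prod]
  intro i _
  have := mul_nonneg (inv_pos.2 hγ).le (gram_diag_nonneg V i)
  positivity

/-- The minimum of the ridge regression problem. -/
theorem ridge_le (hγ : 0 < γ) (B : Matrix n u ℝ) (V : Matrix n k ℝ) (Q : Matrix k u ℝ) :
    (Bᵀ * ((γ • (1 : Matrix n n ℝ) + V * Vᵀ)⁻¹ * B)).trace
      ≤ γ⁻¹ * frob (B - V * Q) + frob Q := by
  have hP := ridge_solution hγ B V
  obtain ⟨P, hPd⟩ : ∃ P, P = (γ • (1 : Matrix n n ℝ) + V * Vᵀ)⁻¹ * B := ⟨_, rfl⟩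
  rw [← hPd] at hP ⊢
  have := ridge hγ (Q - Vᵀ * P) hP
  rw [add_sub_cancel] at this
  have f1 := mul_nonneg (inv_pos.2 hγ).le (frob_nonneg (V * (Q - Vᵀ * P)))
  have f2 := frob_nonneg (Q - Vᵀ * P)
  linarith

/-- Weak duality: any `S` with `B Bᵀ ≤ S` certifies a lower bound for the linear VAE objective. -/
theorem le_vae (hγ : 0 < γ) {S : Matrix n n ℝ} (hS : S.PosDef)
    (hSB : (S - B * Bᵀ).PosSemidef) (V : Matrix n k ℝ) (Q : Matrix k u ℝ) {s : k → ℝ}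
    (hs : ∀ i, s i ≠ 0) :
    Fintype.card n + Fintype.card k + Real.log S.det - Fintype.card n * Real.log γ
      - γ⁻¹ * (S - B * Bᵀ).trace ≤ vae γ B V Q s := by
  have hT := posDef_smul_one_add hγ (posSemidef_mul_transpose V)
  have hdet := shifted_det_le_sum hγ V
  have hld := log_det_le hS hT
  obtain ⟨T, hTd⟩ : ∃ T, T = γ • (1 : Matrix n n ℝ) + V * Vᵀ := ⟨_, rfl⟩
  rw [← hTd] at hT hdet hld
  -- the encoder mean
  have h1 : (Bᵀ * (T⁻¹ * B)).trace ≤ γ⁻¹ * frob (B - V * Q) + frob Q := by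
    rw [hTd]; exact ridge_le hγ B V Q
  -- the encoder variances
  have h2 : Fintype.card k + ∑ i, Real.log (1 + γ⁻¹ * (Vᵀ * V) i i)
      ≤ ∑ i, (s i ^ 2 * (1 + γ⁻¹ * (Vᵀ * V) i i) - Real.log (s i ^ 2)) := by
    have : (Fintype.card k : ℝ) = ∑ _i : k, (1 : ℝ) := by simp
    rw [this, ← Finset.sum_add_distrib]
    refine Finset.sum_le_sum fun i _ => ?_
    have ha : 0 < 1 + γ⁻¹ * (Vᵀ * V) i i := by
      have := mul_nonneg (inv_pos.2 hγ).le (gram_diag_nonneg V i)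
      linarith
    have hsi : 0 < s i ^ 2 := by have := hs i; positivity
    have := Real.log_le_sub_one_of_pos (mul_pos hsi ha)
    rw [Real.log_mul hsi.ne' ha.ne'] at this
    linarith
  -- the inverse covariance is at most `γ⁻¹`
  have h3 : (T⁻¹ * (S - B * Bᵀ)).trace ≤ γ⁻¹ * (S - B * Bᵀ).trace := by
    obtain ⟨F, hF⟩ := exists_transpose_mul_self hSB
    have := ridge_le hγ Fᵀ V (0 : Matrix k n ℝ)
    rw [← hTd, Matrix.mul_zero, sub_zero, frob_zero, add_zero, Matrix.trace_mul_comm,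
      Matrix.mul_assoc, Matrix.transpose_transpose, frob, Matrix.transpose_transpose,
      Matrix.trace_mul_comm F] at this
    rwa [hF]
  have h4 : (Bᵀ * (T⁻¹ * B)).trace = (T⁻¹ * S).trace - (T⁻¹ * (S - B * Bᵀ)).trace := by
    rw [Matrix.trace_mul_comm, Matrix.mul_sub, Matrix.trace_sub, Matrix.mul_assoc]; ring
  rw [vae_eq_sum]
  linarith

theorem shifted_isUnit (hγ : 0 < γ) (V : Matrix n k ℝ) :
    IsUnit (γ • (1 : Matrix n n ℝ) + V * Vᵀ).det :=
  (Matrix.isUnit_iff_isUnit_det _).1 (posDef_smul_one_add hγ (posSemidef_mul_transpose V)).isUnit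

theorem frob_mul_le {n k : Type*} [Fintype n] [Fintype k] (X : Matrix n k ℝ) (Y : Matrix k u ℝ) :
    frob (X * Y) ≤ frob X * frob Y := by
  rw [frob_eq_sum, frob_eq_sum Y, ← frob_transpose X, frob_eq_sum Xᵀ, Finset.mul_sum]
  refine Finset.sum_le_sum fun j _ => ?_
  rw [Finset.sum_mul]
  refine Finset.sum_le_sum fun i _ => ?_
  simp only [Matrix.mul_apply, Matrix.transpose_apply]
  exact Finset.sum_mul_sq_le_sq_mul_sq _ _ _

theorem frob_mul_single {n : Type*} [Fintype n] (V : Matrix n k ℝ) (i : k) :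
    frob (V * Matrix.single i () (1 : ℝ)) = (Vᵀ * V) i i := by
  rw [frob_eq_sum, Matrix.mul_apply]
  simp [sq]

/-- A matrix `L` with `L Bᵀ B = B`. It inverts `Bᵀ` on the column space of `B`, so its squared norm
bounds the inverse of the smallest nonzero eigenvalue of `B Bᵀ`. -/
theorem exists_left_recover (B : Matrix n u ℝ) : ∃ L : Matrix n u ℝ, L * Bᵀ * B = B := by
  obtain ⟨Z, hZ⟩ := exists_normal_eq B (1 : Matrix n n ℝ)
  refine ⟨Zᵀ, ?_⟩
  have := congrArg Matrix.transpose hZ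
  simpa [Matrix.transpose_mul, Matrix.mul_assoc] using this

theorem exists_range_mul_transpose (V : Matrix n k ℝ) : ∃ Z : Matrix n k ℝ, V * Vᵀ * Z = V := by
  obtain ⟨Z, hZ⟩ := exists_normal_eq Vᵀ (1 : Matrix k k ℝ)
  exact ⟨Z, by simpa using hZ⟩

namespace IsOpt

theorem mul_diagonal (hγ : 0 < γ) (h : IsOpt γ B V Q s) :
    (γ • (1 : Matrix n n ℝ) + V * Vᵀ) * V * Matrix.diagonal (fun i => s i ^ 2) = γ • V :=
  shifted_mul_of_orth hγ h.orth h.scale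

theorem inv_mul (hγ : 0 < γ) (h : IsOpt γ B V Q s) :
    (γ • (1 : Matrix n n ℝ) + V * Vᵀ)⁻¹ * V
      = γ⁻¹ • (V * Matrix.diagonal (fun i => s i ^ 2)) := by
  have : V * Matrix.diagonal (fun i => s i ^ 2)
      = γ • ((γ • (1 : Matrix n n ℝ) + V * Vᵀ)⁻¹ * V) := by
    rw [← Matrix.mul_smul, ← h.mul_diagonal hγ, ← Matrix.mul_assoc, ← Matrix.mul_assoc,
      Matrix.nonsing_inv_mul _ (shifted_isUnit hγ V), Matrix.one_mul]
  rw [this, smul_smul, inv_mul_cancel₀ hγ.ne', one_smul]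

/-- `S - B Bᵀ` vanishes on the columns of `V` and `S` is `γ` on their orthogonal complement, so
`(S - B Bᵀ) S⁻¹ = γ⁻¹ (S - B Bᵀ)`. -/
theorem trace_inv (hγ : 0 < γ) (h : IsOpt γ B V Q s) :
    (Bᵀ * ((γ • (1 : Matrix n n ℝ) + V * Vᵀ)⁻¹ * B)).trace
      = Fintype.card n - γ⁻¹ * (γ • (1 : Matrix n n ℝ) + V * Vᵀ - B * Bᵀ).trace := by
  have hu := shifted_isUnit hγ V
  have heig := h.eig
  obtain ⟨S, hS⟩ : ∃ S, S = γ • (1 : Matrix n n ℝ) + V * Vᵀ := ⟨_, rfl⟩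
  rw [← hS] at hu heig ⊢
  have h1 : (S - B * Bᵀ) * S = γ • (S - B * Bᵀ) := by
    nth_rw 2 [hS]
    rw [Matrix.mul_add, ← Matrix.mul_assoc, Matrix.sub_mul _ _ V, heig]
    simp
  have h2 : (S - B * Bᵀ) * S⁻¹ = γ⁻¹ • (S - B * Bᵀ) := by
    have : S - B * Bᵀ = γ • ((S - B * Bᵀ) * S⁻¹) := by
      rw [← Matrix.smul_mul, ← h1, Matrix.mul_assoc, Matrix.mul_nonsing_inv _ hu, Matrix.mul_one]
    nth_rw 2 [this]
    rw [smul_smul, inv_mul_cancel₀ hγ.ne', one_smul]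
  rw [Matrix.trace_mul_comm, Matrix.mul_assoc, Matrix.trace_mul_comm S⁻¹]
  have h4 := congrArg Matrix.trace h2
  rw [Matrix.sub_mul, Matrix.mul_nonsing_inv _ hu, Matrix.trace_sub, Matrix.trace_one,
    Matrix.trace_smul, smul_eq_mul] at h4
  linarith

theorem trace_inv_le (hγ : 0 < γ) (h : IsOpt γ B V Q s) :
    (Bᵀ * ((γ • (1 : Matrix n n ℝ) + V * Vᵀ)⁻¹ * B)).trace ≤ Fintype.card n := by
  rw [h.trace_inv hγ]
  have := mul_nonneg (inv_pos.2 hγ).le h.psd.trace_nonneg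
  linarith

theorem ridge_eq (hγ : 0 < γ) (h : IsOpt γ B V Q s) :
    γ⁻¹ * frob (B - V * Q) + frob Q
      = (Bᵀ * ((γ • (1 : Matrix n n ℝ) + V * Vᵀ)⁻¹ * B)).trace := by
  have := ridge hγ 0 (ridge_solution hγ B V)
  rw [add_zero, ← h.encoder] at this
  simpa [frob_zero] using this

theorem vae_eq (hγ : 0 < γ) (h : IsOpt γ B V Q s) :
    vae γ B V Q s = (Bᵀ * ((γ • (1 : Matrix n n ℝ) + V * Vᵀ)⁻¹ * B)).trace
      + Fintype.card k + ∑ i, Real.log (1 + γ⁻¹ * (Vᵀ * V) i i) := by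
  rw [vae_eq_sum, h.ridge_eq hγ, add_assoc]
  congr 1
  have : (Fintype.card k : ℝ) = ∑ _i : k, (1 : ℝ) := by simp
  rw [this, ← Finset.sum_add_distrib]
  refine Finset.sum_congr rfl fun i _ => ?_
  rw [h.scale i, eq_inv_of_mul_eq_one_left (h.scale i), Real.log_inv, sub_neg_eq_add]

/-- Optimality is global: the choice `S = γ I + V Vᵀ` makes the bound `le_vae` an equality. -/
theorem vae_le (hγ : 0 < γ) (h : IsOpt γ B V Q s) (V' : Matrix n k ℝ) (Q' : Matrix k u ℝ)
    {s' : k → ℝ} (hs' : ∀ i, s' i ≠ 0) : vae γ B V Q s ≤ vae γ B V' Q' s' := by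
  have h1 := le_vae hγ (posDef_smul_one_add hγ (posSemidef_mul_transpose V)) h.psd V' Q' hs'
  have h2 := h.vae_eq hγ
  rw [h.trace_inv hγ] at h2
  have h3 := shifted_det_of_orth hγ h.orth
  linarith

/-- At an optimum the reconstruction error is `γ` times `tr (Bᵀ S⁻¹ B)`, with
`S = γ I + V Vᵀ`. -/
theorem recon_eq (hγ : 0 < γ) (h : IsOpt γ B V Q s) :
    γ⁻¹ * (frob (B - V * Q) + frob (V * Matrix.diagonal s))
      = (Bᵀ * ((γ • (1 : Matrix n n ℝ) + V * Vᵀ)⁻¹ * B)).trace := by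
  rw [← h.ridge_eq hγ, mul_add]
  congr 1
  have hSt : ((γ • (1 : Matrix n n ℝ) + V * Vᵀ)⁻¹)ᵀ = (γ • (1 : Matrix n n ℝ) + V * Vᵀ)⁻¹ :=
    (posDef_smul_one_add hγ (posSemidef_mul_transpose V)).inv.1
  have hinv := h.inv_mul hγ
  have hdiag := h.mul_diagonal hγ
  obtain ⟨D, hD⟩ : ∃ D, D = Matrix.diagonal (fun i => s i ^ 2) := ⟨_, rfl⟩
  have hDt : Dᵀ = D := by rw [hD, Matrix.diagonal_transpose]
  have hDs : D = Matrix.diagonal s * (Matrix.diagonal s)ᵀ := by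
    rw [hD, Matrix.diagonal_transpose, Matrix.diagonal_mul_diagonal]; congr 1; ext; ring
  rw [← hD] at hinv hdiag
  have hQt : Qᵀ = γ⁻¹ • (Bᵀ * (V * D)) := by
    rw [h.encoder, Matrix.transpose_mul, Matrix.transpose_mul, hSt, Matrix.transpose_transpose,
      Matrix.mul_assoc, hinv, Matrix.mul_smul]
  have h1 : B * (Bᵀ * (V * D)) = γ • V := by
    rw [← hdiag, ← h.eig]; simp only [Matrix.mul_assoc]
  have h2 : frob Qᵀ = γ⁻¹ * (D * (Vᵀ * V)).trace := by
    have e : (Bᵀ * (V * D))ᵀ * (Bᵀ * (V * D)) = γ • (D * (Vᵀ * V)) := by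
      rw [Matrix.transpose_mul, Matrix.transpose_transpose, Matrix.mul_assoc, h1,
        Matrix.transpose_mul, hDt, Matrix.mul_smul, Matrix.mul_assoc]
    rw [hQt, frob_smul, frob, e, Matrix.trace_smul, smul_eq_mul]
    field_simp
  have h3 : frob (V * Matrix.diagonal s) = (D * (Vᵀ * V)).trace := by
    rw [frob, hDs, Matrix.transpose_mul, Matrix.mul_assoc, ← Matrix.mul_assoc Vᵀ,
      Matrix.trace_mul_comm, Matrix.mul_assoc, Matrix.trace_mul_comm, Matrix.mul_assoc]
  rw [← frob_transpose Q, h2, h3]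

/-- A nonzero column of `V` has eigenvalue `γ + |v|²` under `B Bᵀ`, which is at most the trace. -/
theorem shifted_gram_le (h : IsOpt γ B V Q s) {i : k}
    (hi : (Vᵀ * V) i i ≠ 0) : γ + (Vᵀ * V) i i ≤ frob B := by
  have h1 : Vᵀ * (B * Bᵀ * V) = γ • (Vᵀ * V) + Vᵀ * V * (Vᵀ * V) := by
    rw [h.eig, Matrix.add_mul, Matrix.mul_add]; simp [Matrix.mul_assoc]
  have h2 := congrFun (congrFun h1 i) i
  have h3 : (Vᵀ * V * (Vᵀ * V)) i i = (Vᵀ * V) i i * (Vᵀ * V) i i := by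
    nth_rw 2 [mul_gram_of_orth h.orth]
    rw [Matrix.mul_diagonal]
  rw [Matrix.add_apply, Matrix.smul_apply, h3, smul_eq_mul] at h2
  have h4 : (Vᵀ * (B * Bᵀ * V)) i i = frob (Bᵀ * (V * (Matrix.single i () (1 : ℝ)))) := by
    rw [← Matrix.mul_assoc Bᵀ, frob_mul_single, Matrix.transpose_mul, Matrix.transpose_transpose]
    simp only [Matrix.mul_assoc]
  have h5 : (Vᵀ * V) i i = frob (V * (Matrix.single i () (1 : ℝ))) :=
    (frob_mul_single V i).symm
  have h6 := frob_mul_le Bᵀ (V * (Matrix.single i () (1 : ℝ)))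
  rw [← h4, ← h5, h2, frob_transpose] at h6
  have h7 : 0 < (Vᵀ * V) i i := lt_of_le_of_ne (gram_diag_nonneg V i) hi.symm
  have : (γ + (Vᵀ * V) i i) * (Vᵀ * V) i i ≤ frob B * (Vᵀ * V) i i := by linarith
  exact le_of_mul_le_mul_right this h7

/-- Below the smallest nonzero eigenvalue of `B Bᵀ`, the columns of `V` span those of `B`. -/
theorem exists_eq_mul (h : IsOpt γ B V Q s) {L : Matrix n u ℝ}
    (hL : L * Bᵀ * B = B) (hsmall : γ * frob L < 1) : ∃ Z : Matrix k u ℝ, B = V * Z := by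
  classical
  obtain ⟨Z₀, hZ₀⟩ := h.range
  obtain ⟨Z, hZ⟩ := exists_normal_eq V B
  refine ⟨Z, ?_⟩
  obtain ⟨W, hW⟩ : ∃ W, W = B - V * Z := ⟨_, rfl⟩
  have hVW : Vᵀ * W = 0 := by rw [hW, Matrix.mul_sub, ← Matrix.mul_assoc, hZ, sub_self]
  have hWB : W = L * (Bᵀ * W) := by
    have : W = B * (1 - Z₀ * Z) := by
      rw [hW, Matrix.mul_sub, Matrix.mul_one, ← Matrix.mul_assoc, ← hZ₀]
    conv_lhs => rw [this, ← hL]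
    rw [this]; simp only [Matrix.mul_assoc]
  have h1 : frob (Bᵀ * W) ≤ γ * frob W := by
    have := trace_quadratic_nonneg h.psd W
    have e : Wᵀ * (γ • (1 : Matrix n n ℝ) + V * Vᵀ - B * Bᵀ) * W
        = γ • (Wᵀ * W) - (Bᵀ * W)ᵀ * (Bᵀ * W) := by
      simp [Matrix.mul_sub, Matrix.sub_mul, Matrix.mul_add, Matrix.add_mul, Matrix.mul_assoc, hVW,
        Matrix.transpose_mul]
    rw [e, Matrix.trace_sub, Matrix.trace_smul, smul_eq_mul] at this
    simpa [frob] using this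
  have h2 : frob W ≤ frob L * frob (Bᵀ * W) := by
    conv_lhs => rw [hWB]
    exact frob_mul_le _ _
  have h3 := frob_nonneg W
  have h4 := mul_le_mul_of_nonneg_left h1 (frob_nonneg L)
  have h5 : frob W = 0 := by
    by_contra hne
    have : 0 < frob W := lt_of_le_of_ne h3 (Ne.symm hne)
    nlinarith
  rw [frob_eq_zero.1 h5] at hW
  exact sub_eq_zero.1 hW.symm

/-- When the columns of `V` span those of `B`, `V Vᵀ` is `B Bᵀ - γ Π`, where `Π = B Y` is the
orthogonal projection to the column space of `B`. -/
theorem mul_transpose_eq (h : IsOpt γ B V Q s) {Z : Matrix k u ℝ} (hZ : B = V * Z)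
    {Y : Matrix u n ℝ} (hY : Bᵀ * B * Y = Bᵀ) : V * Vᵀ = B * Bᵀ - γ • (B * Y) := by
  obtain ⟨Z₀, hZ₀⟩ := h.range
  have h1 : Vᵀ * (B * Y) = Vᵀ := by
    rw [hZ₀, Matrix.transpose_mul, Matrix.mul_assoc, ← Matrix.mul_assoc Bᵀ, hY]
  have h2 : B * Bᵀ * B = γ • B + V * Vᵀ * B := by
    have := congrArg (· * Z) h.eig
    simp only [Matrix.mul_assoc _ V Z, ← hZ] at this
    rw [this, Matrix.add_mul]; simp
  calc V * Vᵀ = V * Vᵀ * B * Y := by rw [Matrix.mul_assoc, Matrix.mul_assoc, h1]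
    _ = (B * Bᵀ * B - γ • B) * Y := by rw [h2, add_sub_cancel_left]
    _ = _ := by
      rw [Matrix.sub_mul, Matrix.mul_assoc B, Matrix.mul_assoc B, hY, Matrix.smul_mul]

end IsOpt

/-- The nonzero ones among orthogonal columns are counted by the rank. -/
theorem card_gram_ne_zero {V : Matrix n k ℝ} (ho : ∀ i j, i ≠ j → (Vᵀ * V) i j = 0) :
    Fintype.card {i // (Vᵀ * V) i i ≠ 0} = V.rank := by
  rw [← Matrix.rank_transpose_mul_self, mul_gram_of_orth ho, Matrix.rank_diagonal]
  simp

/-- The spectral construction of an optimum: scaled eigenvectors of `B Bᵀ` for the eigenvalues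
above the noise level. -/
theorem exists_isOpt (hγ : 0 < γ) (B : Matrix n u ℝ) (hr : B.rank ≤ Fintype.card k) :
    ∃ (V : Matrix n k ℝ) (K : Matrix k n ℝ) (s : k → ℝ), (∀ i, s i ≠ 0) ∧
      IsOpt γ B V (K * B) s := by
  have hC : (B * Bᵀ).IsHermitian := (posSemidef_mul_transpose B).1
  obtain ⟨l, hl⟩ : ∃ l, l = hC.eigenvalues := ⟨_, rfl⟩
  have hcard : Fintype.card {i // l i ≠ 0} ≤ Fintype.card k := by
    rw [hl, ← hC.rank_eq_card_non_zero_eigs, Matrix.rank_self_mul_transpose]; exact hr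
  obtain ⟨f⟩ := Function.Embedding.nonempty_of_card_le hcard
  obtain ⟨U, hUd⟩ : ∃ U : Matrix n n ℝ, U = hC.eigenvectorUnitary := ⟨_, rfl⟩
  have hUU : Uᵀ * U = 1 := by
    have := Unitary.coe_star_mul_self hC.eigenvectorUnitary
    rw [hUd]; simpa [Matrix.star_eq_conjTranspose] using this
  have hUU' : U * Uᵀ = 1 := by
    have := Unitary.coe_mul_star_self hC.eigenvectorUnitary
    rw [hUd]; simpa [Matrix.star_eq_conjTranspose] using this
  have hspec : B * Bᵀ = U * Matrix.diagonal l * Uᵀ := by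
    have := hC.spectral_theorem
    rw [Unitary.conjStarAlgAut_apply] at this
    rw [hUd, hl]
    conv_lhs => rw [this]
    simp [Matrix.star_eq_conjTranspose]
  obtain ⟨r, hrd⟩ : ∃ r : n → ℝ, r = fun i => Real.sqrt (max (l i - γ) 0) := ⟨_, rfl⟩
  have hr2 : ∀ i, r i * r i = max (l i - γ) 0 := fun i => by
    rw [hrd]; exact Real.mul_self_sqrt (le_max_right _ _)
  have hr0 : ∀ i, l i = 0 → r i = 0 := fun i hi => by
    rw [hrd]; simp [hi, hγ.le]
  -- the coordinates of `V` in the eigenbasis: `f` assigns a column to each nonzero eigenvalue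
  obtain ⟨W, hW⟩ : ∃ W : Matrix n k ℝ, W = Matrix.of fun i a =>
    if h : l i ≠ 0 then (if f ⟨i, h⟩ = a then r i else 0) else 0 := ⟨_, rfl⟩
  have hWW : W * Wᵀ = Matrix.diagonal fun i => max (l i - γ) 0 := by
    ext i j
    rw [Matrix.mul_apply]
    by_cases hi : l i = 0
    · have : max (l i - γ) 0 = 0 := by rw [← hr2, hr0 i hi, mul_zero]
      rw [Matrix.diagonal_apply]
      simp [hW, hi, hγ.le]
    · by_cases hj : l j = 0
      · have hij : i ≠ j := fun h => hi (h ▸ hj)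
        simp [hW, hj, hij]
      · by_cases hij : i = j
        · subst hij; simp [hW, hi, hr2]
        · have : f ⟨j, hj⟩ ≠ f ⟨i, hi⟩ := fun h => hij (by simpa using (f.injective h).symm)
          simp [hW, hi, hj, hij]
  have hWo : ∀ a b, a ≠ b → (Wᵀ * W) a b = 0 := by
    intro a b hab
    rw [Matrix.mul_apply]
    refine Finset.sum_eq_zero fun i _ => ?_
    by_cases hi : l i = 0
    · simp [hW, hi]
    · by_cases hfa : f ⟨i, hi⟩ = a
      · have : f ⟨i, hi⟩ ≠ b := fun h => hab (hfa.symm.trans h)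
        simp [hW, hi, this]
      · simp [hW, hi, hfa]
  obtain ⟨V, hV⟩ : ∃ V, V = U * W := ⟨_, rfl⟩
  have hVV : V * Vᵀ = U * (Matrix.diagonal fun i => max (l i - γ) 0) * Uᵀ := by
    rw [hV, Matrix.transpose_mul, ← hWW]; simp only [Matrix.mul_assoc]
  have hVo : ∀ a b, a ≠ b → (Vᵀ * V) a b = 0 := by
    have : Vᵀ * V = Wᵀ * W := by
      rw [hV, Matrix.transpose_mul, Matrix.mul_assoc, ← Matrix.mul_assoc Uᵀ, hUU, Matrix.one_mul]
    rw [this]; exact hWo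
  have hS : γ • (1 : Matrix n n ℝ) + V * Vᵀ
      = U * (Matrix.diagonal fun i => γ + max (l i - γ) 0) * Uᵀ := by
    rw [hVV, ← hUU', ← Matrix.diagonal_add, Matrix.mul_add, Matrix.add_mul,
      ← Matrix.smul_one_eq_diagonal]
    simp
  have hpos : ∀ i, 0 < 1 + γ⁻¹ * (Vᵀ * V) i i := fun i => by
    have := mul_nonneg (inv_pos.2 hγ).le (gram_diag_nonneg V i)
    linarith
  obtain ⟨s, hs⟩ : ∃ s : k → ℝ, s = fun i => Real.sqrt (1 + γ⁻¹ * (Vᵀ * V) i i)⁻¹ := ⟨_, rfl⟩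
  have hsc : ∀ i, s i ^ 2 * (1 + γ⁻¹ * (Vᵀ * V) i i) = 1 := fun i => by
    rw [hs, Real.sq_sqrt (inv_pos.2 (hpos i)).le, inv_mul_cancel₀ (hpos i).ne']
  have heig : B * Bᵀ * V = (γ • (1 : Matrix n n ℝ) + V * Vᵀ) * V := by
    rw [hS, hspec, hV]
    have e : ∀ D : Matrix n n ℝ, U * D * Uᵀ * (U * W) = U * (D * W) := fun D => by
      rw [Matrix.mul_assoc (U * D), ← Matrix.mul_assoc Uᵀ, hUU, Matrix.one_mul, Matrix.mul_assoc]
    rw [e, e]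
    congr 1
    ext i a
    rw [Matrix.diagonal_mul, Matrix.diagonal_mul]
    rcases le_total (l i) γ with hle | hle
    · have : r i = 0 := by rw [hrd]; simp [hle]
      simp [hW, this]
    · rw [max_eq_left (by linarith)]; ring
  refine ⟨V, Vᵀ * (γ • (1 : Matrix n n ℝ) + V * Vᵀ)⁻¹, s, fun i hi => ?_, ?_, hVo,
    Matrix.mul_assoc _ _ _, hsc, heig, ?_⟩
  · have := hsc i
    rw [hi] at this; norm_num at this
  · refine ⟨γ⁻¹ • (Bᵀ * V * Matrix.diagonal fun i => s i ^ 2), ?_⟩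
    rw [Matrix.mul_smul, ← Matrix.mul_assoc, ← Matrix.mul_assoc, heig,
      shifted_mul_of_orth hγ hVo hsc, smul_smul, inv_mul_cancel₀ hγ.ne', one_smul]
  · rw [hS, hspec, ← Matrix.sub_mul, ← Matrix.mul_sub, Matrix.diagonal_sub]
    have : (Matrix.diagonal fun i => γ + max (l i - γ) 0 - l i).PosSemidef :=
      Matrix.PosSemidef.diagonal fun i => by
        have := le_max_left (l i - γ) 0
        simp only [Pi.zero_apply]; linarith
    simpa using this.mul_mul_conjTranspose_same U

end CycleCVAE

/-! ### Moments of the data and the feasible set -/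

namespace CycleCVAE

set_option linter.unusedSectionVars false

/-- Second moments of uncorrelated coordinates integrate quadratic forms. -/
theorem integral_quadratic {Ω : Type*} [MeasurableSpace Ω] {μ : Measure Ω} {ι n : Type*}
    [Fintype ι] [DecidableEq ι] [Fintype n] {w : Ω → ι → ℝ} {δ : ι → ℝ}
    (hw : ∀ i, MemLp (fun ω => w ω i) 2 μ)
    (hδ : ∀ i j, ∫ ω, w ω i * w ω j ∂μ = if i = j then δ i else 0)
    (G : Matrix n ι ℝ) (K : Matrix n n ℝ) :
    Integrable (fun ω => (G *ᵥ w ω) ⬝ᵥ (K *ᵥ (G *ᵥ w ω))) μ ∧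
      ∫ ω, (G *ᵥ w ω) ⬝ᵥ (K *ᵥ (G *ᵥ w ω)) ∂μ = ∑ i, δ i * (Gᵀ * K * G) i i := by
  have hexp : (fun ω => (G *ᵥ w ω) ⬝ᵥ (K *ᵥ (G *ᵥ w ω)))
      = fun ω => ∑ i, ∑ j, (Gᵀ * K * G) i j * (w ω i * w ω j) := by
    funext ω
    rw [Matrix.mulVec_mulVec, ← Matrix.vecMul_transpose, ← Matrix.dotProduct_mulVec,
      Matrix.mulVec_mulVec, ← Matrix.mul_assoc, dotProduct]
    refine Finset.sum_congr rfl fun i _ => ?_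
    rw [Matrix.mulVec, dotProduct, Finset.mul_sum]
    exact Finset.sum_congr rfl fun j _ => by ring
  have hint : ∀ i j, Integrable (fun ω => (Gᵀ * K * G) i j * (w ω i * w ω j)) μ :=
    fun i j => ((hw i).integrable_mul (hw j)).const_mul _
  rw [hexp]
  refine ⟨integrable_finsetSum _ fun i _ => integrable_finsetSum _ fun j _ => hint i j, ?_⟩
  rw [integral_finsetSum _ fun i _ => integrable_finsetSum _ fun j _ => hint i j]
  refine Finset.sum_congr rfl fun i _ => ?_
  rw [integral_finsetSum _ fun j _ => hint i j]
  simp only [integral_const_mul, hδ]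
  simp [mul_comm]

theorem frob_fromCols {n k e : Type*} [Fintype n] [Fintype k] [Fintype e] (X : Matrix n e ℝ)
    (Y : Matrix n k ℝ) : frob (Matrix.fromCols X Y) = frob X + frob Y := by
  simp [frob_eq_sum, Fintype.sum_sum_type]

/-- The matrix `[b, W]` of the affine map `y ↦ W y + b`, which acts on the vector `(1, y)`. -/
def aug {n m : Type*} (b : n → ℝ) (W : Matrix n m ℝ) : Matrix n (Unit ⊕ m) ℝ :=
  Matrix.fromCols (Matrix.replicateCol Unit b) W

theorem aug_mulVec {n m : Type*} [Fintype m] (b : n → ℝ) (W : Matrix n m ℝ) (y : m → ℝ) :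
    aug b W *ᵥ Sum.elim (fun _ => 1) y = b + W *ᵥ y := by
  ext i
  simp [aug, Matrix.mulVec, dotProduct, Fintype.sum_sum_type]

theorem sum_diag_gram {n k : Type*} [Fintype n] [Fintype k] (G : Matrix n k ℝ) :
    ∑ i, (Gᵀ * G) i i = frob G := rfl

theorem integrable_sqNorm {Ω : Type*} [MeasurableSpace Ω] {μ : Measure Ω} {ι : Type*} {n : ℕ}
    [Fintype ι] [DecidableEq ι] {w : Ω → ι → ℝ} {δ : ι → ℝ}
    (hw : ∀ i, MemLp (fun ω => w ω i) 2 μ)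
    (hδ : ∀ i j, ∫ ω, w ω i * w ω j ∂μ = if i = j then δ i else 0) (G : Matrix (Fin n) ι ℝ) :
    Integrable (fun ω => sqNorm (G *ᵥ w ω)) μ ∧
      ∫ ω, sqNorm (G *ᵥ w ω) ∂μ = ∑ i, δ i * (Gᵀ * G) i i := by
  have := integral_quadratic hw hδ G 1
  simpa [sqNorm] using this

section Gaussian

variable {rz : ℕ} (m s : Fin rz → ℝ)

theorem gaussian_pi_memLp (k : Fin rz) :
    MemLp (fun z : Fin rz → ℝ => z k - m k) 2
      (Measure.pi fun k => gaussianReal (m k) (Real.toNNReal (s k ^ 2))) := by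
  have h := memLp_id_gaussianReal (μ := m k) (v := Real.toNNReal (s k ^ 2)) 2
  have := h.comp_measurePreserving
    (measurePreserving_eval (fun k => gaussianReal (m k) (Real.toNNReal (s k ^ 2))) k)
  exact this.sub (memLp_const (m k))

theorem gaussian_pi_mean (k : Fin rz) :
    ∫ z : Fin rz → ℝ, (z k - m k)
      ∂(Measure.pi fun k => gaussianReal (m k) (Real.toNNReal (s k ^ 2))) = 0 := by
  rw [integral_comp_eval (μ := fun k => gaussianReal (m k) (Real.toNNReal (s k ^ 2)))
    (f := fun t => t - m k) (by fun_prop)]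
  have h : Integrable (fun t : ℝ => t) (gaussianReal (m k) (Real.toNNReal (s k ^ 2))) :=
    (memLp_id_gaussianReal (μ := m k) (v := Real.toNNReal (s k ^ 2)) 1).integrable le_rfl
  rw [integral_sub h (integrable_const _), integral_id_gaussianReal]
  simp

theorem gaussian_pi_cov (k l : Fin rz) :
    ∫ z : Fin rz → ℝ, (z k - m k) * (z l - m l)
      ∂(Measure.pi fun k => gaussianReal (m k) (Real.toNNReal (s k ^ 2)))
      = if k = l then s k ^ 2 else 0 := by
  split_ifs with hkl
  · subst hkl
    rw [integral_comp_eval (μ := fun k => gaussianReal (m k) (Real.toNNReal (s k ^ 2)))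
      (f := fun t => (t - m k) * (t - m k)) (by fun_prop)]
    have h := variance_fun_id_gaussianReal (μ := m k) (v := Real.toNNReal (s k ^ 2))
    rw [variance_eq_integral (by fun_prop), integral_id_gaussianReal,
      Real.coe_toNNReal _ (sq_nonneg _)] at h
    simpa only [← sq] using h
  · have hi : iIndepFun (fun k (z : Fin rz → ℝ) => z k - m k)
        (Measure.pi fun k => gaussianReal (m k) (Real.toNNReal (s k ^ 2))) :=
      iIndepFun_pi (X := fun k t => t - m k) fun k => by fun_prop
    rw [(hi.indepFun hkl).integral_fun_mul_eq_mul_integral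
      (gaussian_pi_memLp m s k).1 (gaussian_pi_memLp m s l).1, gaussian_pi_mean, zero_mul]

/-- The expected reconstruction error under an encoder with independent Gaussian coordinates. -/
theorem integral_gaussian_sqNorm {n : ℕ} (a : Fin n → ℝ) (V : Matrix (Fin n) (Fin rz) ℝ) :
    ∫ z : Fin rz → ℝ, sqNorm (a - V *ᵥ z)
      ∂(Measure.pi fun k => gaussianReal (m k) (Real.toNNReal (s k ^ 2)))
      = sqNorm (a - V *ᵥ m) + frob (V * Matrix.diagonal s) := by
  set q := Measure.pi fun k => gaussianReal (m k) (Real.toNNReal (s k ^ 2))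
  have h := integrable_sqNorm (μ := q)
    (w := fun z : Fin rz → ℝ => Sum.elim (fun _ : Unit => (1 : ℝ)) (fun k => z k - m k))
    (δ := Sum.elim (fun _ => 1) fun k => s k ^ 2)
    (by
      rintro (i | k)
      · simpa using memLp_const (1 : ℝ)
      · simpa using gaussian_pi_memLp m s k)
    (by
      rintro (i | k) (j | l)
      · simp [q]
      · simpa using gaussian_pi_mean m s l
      · simpa using gaussian_pi_mean m s k
      · simpa using gaussian_pi_cov m s k l)
    (aug (a - V *ᵥ m) (-V))
  have e : ∀ z : Fin rz → ℝ, aug (a - V *ᵥ m) (-V) *ᵥ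
      Sum.elim (fun _ : Unit => (1 : ℝ)) (fun k => z k - m k) = a - V *ᵥ z := fun z => by
    have : (fun k => z k - m k) = z - m := rfl
    rw [aug_mulVec, this, Matrix.neg_mulVec, Matrix.mulVec_sub]
    abel
  simp only [e] at h
  rw [h.2, frob_mul_diagonal, Fintype.sum_sum_type]
  simp [aug, Matrix.mul_apply, sqNorm, dotProduct]

end Gaussian

section Data

variable {Ω : Type*} [MeasurableSpace Ω] {μ : Measure Ω} [IsProbabilityMeasure μ]
    {rx ry rz ru : ℕ} {x : Ω → Fin rx → ℝ} {y : Ω → Fin ry → ℝ} {u : Ω → Fin ru → ℝ}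
    {A : Matrix (Fin rx) (Fin ry) ℝ} {B : Matrix (Fin rx) (Fin ru) ℝ} {c : Fin rx → ℝ}
    {D : Matrix (Fin ry) (Fin rx) ℝ} {e : Fin ry → ℝ}

/-- The vector `(1, y, u)`, whose second moment matrix is the identity. -/
def latent (y : Ω → Fin ry → ℝ) (u : Ω → Fin ru → ℝ) (ω : Ω) : (Unit ⊕ Fin ry) ⊕ Fin ru → ℝ :=
  Sum.elim (Sum.elim (fun _ => 1) (y ω)) (u ω)

namespace AffineSurjectiveModel

theorem latent_memLp (h : AffineSurjectiveModel μ x y u A B c D e)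
    (i : (Unit ⊕ Fin ry) ⊕ Fin ru) : MemLp (fun ω => latent y u ω i) 2 μ := by
  rcases i with (i | i) | i
  · simpa [latent] using memLp_const (1 : ℝ)
  · exact h.memLp_y i
  · exact h.memLp_u i

theorem latent_moment (h : AffineSurjectiveModel μ x y u A B c D e)
    (i j : (Unit ⊕ Fin ry) ⊕ Fin ru) :
    ∫ ω, latent y u ω i * latent y u ω j ∂μ = if i = j then 1 else 0 := by
  have hyu : ∀ i j, ∫ ω, y ω i * u ω j ∂μ = 0 := fun i j => by
    have := h.cov_y_u i j
    rw [covariance_eq_sub (h.memLp_y i) (h.memLp_u j), h.mean_y i, zero_mul, sub_zero] at this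
    exact this
  rcases i with (i | i) | i <;> rcases j with (j | j) | j
  · simp [latent]
  · simpa [latent] using h.mean_y j
  · simpa [latent] using h.mean_u j
  · simpa [latent] using h.mean_y i
  · have := h.cov_y i j
    rw [covariance_eq_sub (h.memLp_y i) (h.memLp_y j), h.mean_y i, zero_mul, sub_zero,
      Matrix.one_apply] at this
    simpa [latent] using this
  · simpa [latent] using hyu i j
  · simpa [latent] using h.mean_u i
  · simpa [latent, mul_comm] using hyu j i
  · have := h.cov_u i j
    rw [covariance_eq_sub (h.memLp_u i) (h.memLp_u j), h.mean_u i, zero_mul, sub_zero,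
      Matrix.one_apply] at this
    simpa [latent] using this

theorem integral_sqNorm_latent (h : AffineSurjectiveModel μ x y u A B c D e) {n : ℕ}
    (G : Matrix (Fin n) ((Unit ⊕ Fin ry) ⊕ Fin ru) ℝ) :
    Integrable (fun ω => sqNorm (G *ᵥ latent y u ω)) μ ∧
      ∫ ω, sqNorm (G *ᵥ latent y u ω) ∂μ = frob G := by
  have := integrable_sqNorm (δ := fun _ => 1) h.latent_memLp (h.latent_moment) G
  simpa [← sum_diag_gram] using this

theorem aemeasurable_y (h : AffineSurjectiveModel μ x y u A B c D e) : AEMeasurable y μ :=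
  aemeasurable_pi_iff.2 fun i => (h.memLp_y i).1.aemeasurable

theorem aemeasurable_u (h : AffineSurjectiveModel μ x y u A B c D e) : AEMeasurable u μ :=
  aemeasurable_pi_iff.2 fun i => (h.memLp_u i).1.aemeasurable

theorem aemeasurable_affine (h : AffineSurjectiveModel μ x y u A B c D e) {n : ℕ}
    (W : Matrix (Fin n) (Fin ry) ℝ) (V : Matrix (Fin n) (Fin ru) ℝ) (b : Fin n → ℝ) :
    AEMeasurable (fun ω => W *ᵥ y ω + V *ᵥ u ω + b) μ := by
  have h1 : Continuous fun v : Fin ry → ℝ => W *ᵥ v := by fun_prop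
  have h2 : Continuous fun v : Fin ru → ℝ => V *ᵥ v := by fun_prop
  exact ((h1.measurable.comp_aemeasurable h.aemeasurable_y).add
    (h2.measurable.comp_aemeasurable h.aemeasurable_u)).add_const b

theorem aemeasurable_x (h : AffineSurjectiveModel μ x y u A B c D e) : AEMeasurable x μ :=
  (h.aemeasurable_affine A B c).congr (h.x_eq.mono fun _ hω => hω.symm)

theorem x_eq_latent (h : AffineSurjectiveModel μ x y u A B c D e) :
    ∀ᵐ ω ∂μ, x ω = Matrix.fromCols (aug c A) B *ᵥ latent y u ω := by
  filter_upwards [h.x_eq] with ω hω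
  rw [hω, latent, Matrix.fromCols_mulVec]
  have : aug c A *ᵥ Sum.elim (fun _ => 1) (y ω) = c + A *ᵥ y ω := aug_mulVec _ _ _
  simp only [Function.comp_def, Sum.elim_inl, Sum.elim_inr] at this ⊢
  rw [show (fun i => Sum.elim (fun _ => (1 : ℝ)) (y ω) i) = Sum.elim (fun _ => 1) (y ω) from rfl,
    this]
  abel

theorem hPlus_eq (h : AffineSurjectiveModel μ x y u A B c D e) {θ : Decoder rx ry rz}
    (hA : θ.Wy * A = 1) (hB : θ.Wy * B = 0) (hb : θ.b_y = -(θ.Wy *ᵥ c)) :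
    ∀ᵐ ω ∂μ, θ.hPlus (x ω) = y ω := by
  filter_upwards [h.x_eq] with ω hω
  rw [Decoder.hPlus, hω, Matrix.mulVec_add, Matrix.mulVec_add, Matrix.mulVec_mulVec,
    Matrix.mulVec_mulVec, hA, hB, hb]
  simp

/-- The constraint on the law of `ŷ` pins `Wy` on the columns of `A` and `B` as well as the offset:
comparing means removes the offset, and identifiability does the rest. -/
theorem feasible_iff (h : AffineSurjectiveModel μ x y u A B c D e) (p : Params rx ry rz) :
    p ∈ feasible rz (μ.map x) (μ.map y) ↔ (∀ k, p.2.s k ≠ 0) ∧ p.1.Wy * A = 1 ∧ p.1.Wy * B = 0 ∧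
      p.1.b_y = -(p.1.Wy *ᵥ c) := by
  have hcont : Continuous p.1.hPlus := by unfold Decoder.hPlus; fun_prop
  have hmap : (μ.map x).map p.1.hPlus = μ.map fun ω => p.1.hPlus (x ω) :=
    AEMeasurable.map_map_of_aemeasurable hcont.measurable.aemeasurable h.aemeasurable_x
  refine and_congr_right fun _ => ?_
  rw [hmap]
  constructor
  · intro heq
    obtain ⟨b, hb⟩ : ∃ b, b = p.1.Wy *ᵥ c + p.1.b_y := ⟨_, rfl⟩
    have hae : (fun ω => p.1.hPlus (x ω)) =ᵐ[μ]
        fun ω => (p.1.Wy * A) *ᵥ y ω + (p.1.Wy * B) *ᵥ u ω + b := by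
      filter_upwards [h.x_eq] with ω hω
      rw [Decoder.hPlus, hω, Matrix.mulVec_add, Matrix.mulVec_add, Matrix.mulVec_mulVec,
        Matrix.mulVec_mulVec, hb, add_assoc]
    rw [Measure.map_congr hae] at heq
    have hb0 : b = 0 := by
      ext i
      have h1 : ∫ ω, ((p.1.Wy * A) *ᵥ y ω + (p.1.Wy * B) *ᵥ u ω + b) i ∂μ = ∫ ω, y ω i ∂μ := by
        have hi : Measurable fun v : Fin ry → ℝ => v i := measurable_pi_apply i
        rw [← integral_map (h.aemeasurable_affine _ _ b)
          (f := fun v => v i) hi.aestronglyMeasurable, heq,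
          integral_map h.aemeasurable_y hi.aestronglyMeasurable]
      have iy : ∀ j, Integrable (fun ω => (p.1.Wy * A) i j * y ω j) μ := fun j =>
        ((h.memLp_y j).integrable (by norm_num)).const_mul _
      have iu : ∀ j, Integrable (fun ω => (p.1.Wy * B) i j * u ω j) μ := fun j =>
        ((h.memLp_u j).integrable (by norm_num)).const_mul _
      have iY : Integrable (fun ω => ∑ j, (p.1.Wy * A) i j * y ω j) μ :=
        integrable_finsetSum _ fun j _ => iy j
      have iU : Integrable (fun ω => ∑ j, (p.1.Wy * B) i j * u ω j) μ :=
        integrable_finsetSum _ fun j _ => iu j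
      simp only [Pi.add_apply, Matrix.mulVec, dotProduct] at h1
      rw [integral_add (by exact iY.add iU) (integrable_const _), integral_add iY iU,
        integral_finsetSum _ fun j _ => iy j, integral_finsetSum _ fun j _ => iu j,
        h.mean_y i] at h1
      simpa [integral_const_mul, h.mean_y, h.mean_u] using h1
    rw [hb0] at heq
    simp only [add_zero] at heq
    obtain ⟨hA, hB⟩ := (h.identifiable _ _).1 heq
    exact ⟨hA, hB, (neg_eq_of_add_eq_zero_right (hb.symm.trans hb0)).symm⟩
  · rintro ⟨hA, hB, hb⟩
    exact Measure.map_congr (h.hPlus_eq hA hB hb)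

end AffineSurjectiveModel

end Data

end CycleCVAE

/-! ### The cycle loss in reduced form -/

namespace CycleCVAE

set_option linter.unusedSectionVars false

variable {Ω : Type*} [MeasurableSpace Ω] {μ : Measure Ω} [IsProbabilityMeasure μ]
    {rx ry rz ru : ℕ} {x : Ω → Fin rx → ℝ} {y : Ω → Fin ry → ℝ} {u : Ω → Fin ru → ℝ}
    {A : Matrix (Fin rx) (Fin ry) ℝ} {B : Matrix (Fin rx) (Fin ru) ℝ} {c : Fin rx → ℝ}
    {D : Matrix (Fin ry) (Fin rx) ℝ} {e : Fin ry → ℝ}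

theorem mul_aug {p n m : Type*} [Fintype n] (W : Matrix p n ℝ) (b : n → ℝ) (M : Matrix n m ℝ) :
    W * aug b M = aug (W *ᵥ b) (W * M) := by
  ext i (j | j) <;> simp [aug, Matrix.mul_apply, Matrix.mulVec, dotProduct]

theorem aug_sub {n m : Type*} (b b' : n → ℝ) (M M' : Matrix n m ℝ) :
    aug b M - aug b' M' = aug (b - b') (M - M') := by
  ext i (j | j) <;> simp [aug]

theorem aug_add {n m : Type*} (b b' : n → ℝ) (M M' : Matrix n m ℝ) :
    aug b M + aug b' M' = aug (b + b') (M + M') := by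
  ext i (j | j) <;> simp [aug]

theorem fromCols_aug_latent {n : Type*} (b : n → ℝ) (M : Matrix n (Fin ry) ℝ)
    (N : Matrix n (Fin ru) ℝ) (ω : Ω) :
    Matrix.fromCols (aug b M) N *ᵥ latent y u ω = b + M *ᵥ y ω + N *ᵥ u ω := by
  rw [latent, Matrix.fromCols_mulVec]
  have h1 : (Sum.elim (Sum.elim (fun _ : Unit => (1 : ℝ)) (y ω)) (u ω)) ∘ Sum.inl
    = Sum.elim (fun _ : Unit => (1 : ℝ)) (y ω) := rfl
  have h2 : (Sum.elim (Sum.elim (fun _ : Unit => (1 : ℝ)) (y ω)) (u ω)) ∘ Sum.inr = u ω := rfl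
  rw [h1, h2, aug_mulVec]

/-- The deviation of the decoder offset and `y`-part from `[c, A]`. -/
def Decoder.dev (A : Matrix (Fin rx) (Fin ry) ℝ) (c : Fin rx → ℝ) (θ : Decoder rx ry rz) :
    Matrix (Fin rx) (Unit ⊕ Fin ry) ℝ := aug θ.bx θ.Wx - aug c A

/-- The offset and `y`-part of the encoder mean, as a function of the latent vector. -/
def Encoder.resp (A : Matrix (Fin rx) (Fin ry) ℝ) (c : Fin rx → ℝ) (φ : Encoder rx rz) :
    Matrix (Fin rz) (Unit ⊕ Fin ry) ℝ := aug (φ.Wz *ᵥ c + φ.bz) (φ.Wz * A)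

namespace AffineSurjectiveModel

/-- The loss of the cycle `x → ŷ → x̂`: integrate out `z`, write `x` in terms of `(1, y, u)`, and
use that this vector is white. -/
theorem lossX_eq (h : AffineSurjectiveModel μ x y u A B c D e) {p : Params rx ry rz} (γ : ℝ)
    (hA : p.1.Wy * A = 1) (hB : p.1.Wy * B = 0) (hb : p.1.b_y = -(p.1.Wy *ᵥ c)) :
    lossX (μ.map x) p γ = γ⁻¹ * frob (p.1.dev A c + p.1.Vx * p.2.resp A c)
      + frob (p.2.resp A c) + vae γ B p.1.Vx (p.2.Wz * B) p.2.s + rx * Real.log γ := by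
  have hinner : ∀ v, ∫ z, 1 / γ * sqNorm (v - p.1.h (p.1.hPlus v) z) ∂(p.2.q v)
      = 1 / γ * (sqNorm (v - p.1.h (p.1.hPlus v) (p.2.mean v))
        + frob (p.1.Vx * Matrix.diagonal p.2.s)) := fun v => by
    have e1 : ∀ z, v - p.1.h (p.1.hPlus v) z
        = (v - p.1.Wx *ᵥ p.1.hPlus v - p.1.bx) - p.1.Vx *ᵥ z := fun z => by
      rw [Decoder.h]; abel
    rw [integral_const_mul]
    simp only [e1]
    rw [Encoder.q, integral_gaussian_sqNorm]
  simp only [lossX, hinner]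
  have hm : Continuous p.2.mean := by unfold Encoder.mean; fun_prop
  have hp : Continuous p.1.hPlus := by unfold Decoder.hPlus; fun_prop
  have hc : Continuous fun v => 1 / γ * (sqNorm (v - p.1.h (p.1.hPlus v) (p.2.mean v))
        + frob (p.1.Vx * Matrix.diagonal p.2.s)) + rx * Real.log γ
        + ∑ k, (p.2.s k ^ 2 - Real.log (p.2.s k ^ 2)) + sqNorm (p.2.mean v) := by
    unfold Decoder.h sqNorm
    fun_prop
  rw [integral_map h.aemeasurable_x hc.aestronglyMeasurable]
  have hae : ∀ᵐ ω ∂μ, 1 / γ * (sqNorm (x ω - p.1.h (p.1.hPlus (x ω)) (p.2.mean (x ω)))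
        + frob (p.1.Vx * Matrix.diagonal p.2.s)) + rx * Real.log γ
        + ∑ k, (p.2.s k ^ 2 - Real.log (p.2.s k ^ 2)) + sqNorm (p.2.mean (x ω))
      = 1 / γ * (sqNorm (Matrix.fromCols (-(p.1.dev A c + p.1.Vx * p.2.resp A c))
            (B - p.1.Vx * (p.2.Wz * B)) *ᵥ latent y u ω)
        + frob (p.1.Vx * Matrix.diagonal p.2.s)) + rx * Real.log γ
        + ∑ k, (p.2.s k ^ 2 - Real.log (p.2.s k ^ 2))
        + sqNorm (Matrix.fromCols (p.2.resp A c) (p.2.Wz * B) *ᵥ latent y u ω) := by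
    filter_upwards [h.x_eq, h.hPlus_eq hA hB hb] with ω hω hω'
    have e1 : p.2.mean (x ω)
        = Matrix.fromCols (p.2.resp A c) (p.2.Wz * B) *ᵥ latent y u ω := by
      rw [Encoder.resp, fromCols_aug_latent, Encoder.mean, hω]
      simp only [Matrix.mulVec_add, Matrix.mulVec_mulVec]
      abel
    have e2 : x ω - p.1.h (p.1.hPlus (x ω)) (p.2.mean (x ω))
        = Matrix.fromCols (-(p.1.dev A c + p.1.Vx * p.2.resp A c))
            (B - p.1.Vx * (p.2.Wz * B)) *ᵥ latent y u ω := by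
      have : -(p.1.dev A c + p.1.Vx * p.2.resp A c)
          = aug c A - (aug p.1.bx p.1.Wx + p.1.Vx * p.2.resp A c) := by rw [Decoder.dev]; abel
      rw [this, e1, Encoder.resp, fromCols_aug_latent, mul_aug, aug_add, aug_sub,
        fromCols_aug_latent, Decoder.h, hω', hω]
      simp only [Matrix.mulVec_add, Matrix.sub_mulVec, Matrix.add_mulVec, Matrix.mulVec_mulVec]
      abel
    rw [e2, e1]
  rw [integral_congr_ae hae]
  have i1 := h.integral_sqNorm_latent (Matrix.fromCols (-(p.1.dev A c + p.1.Vx * p.2.resp A c))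
            (B - p.1.Vx * (p.2.Wz * B)))
  have i2 := h.integral_sqNorm_latent (Matrix.fromCols (p.2.resp A c) (p.2.Wz * B))
  have j1 := i1.1.add (integrable_const (μ := μ) (frob (p.1.Vx * Matrix.diagonal p.2.s)))
  have j2 := (j1.const_mul (1 / γ)).add (integrable_const (μ := μ) (rx * Real.log γ))
  have j3 := j2.add (integrable_const (μ := μ) (∑ k, (p.2.s k ^ 2 - Real.log (p.2.s k ^ 2))))
  rw [integral_add (by exact j3) i2.1, integral_add (by exact j2) (integrable_const _),
    integral_add (by exact j1.const_mul _) (integrable_const _), integral_const_mul,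
    integral_add i1.1 (integrable_const _), i1.2, i2.2, frob_fromCols, frob_fromCols, frob_neg, vae]
  simp only [integral_const, probReal_univ, one_smul]
  ring

theorem lossY_eq (h : AffineSurjectiveModel μ x y u A B c D e) {θ : Decoder rx ry rz} (γ : ℝ)
    (hA : θ.Wy * A = 1) (hb : θ.b_y = -(θ.Wy *ᵥ c)) :
    lossY (μ.map y) θ γ = ((θ.Wy * θ.dev A c)ᵀ
      * (γ • (1 : Matrix (Fin ry) (Fin ry) ℝ) + θ.Wy * θ.Vx * θ.Vxᵀ * θ.Wyᵀ)⁻¹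
      * (θ.Wy * θ.dev A c)).trace
      + Real.log (γ • (1 : Matrix (Fin ry) (Fin ry) ℝ) + θ.Wy * θ.Vx * θ.Vxᵀ * θ.Wyᵀ).det := by
  rw [← Decoder.sigmaY]
  have hc : Continuous fun v => θ.epsY v ⬝ᵥ ((θ.sigmaY γ)⁻¹ *ᵥ θ.epsY v)
      + Real.log (θ.sigmaY γ).det := by
    unfold Decoder.epsY; fun_prop
  rw [lossY, integral_map h.aemeasurable_y hc.aestronglyMeasurable]
  have e1 : ∀ ω, θ.epsY (y ω)
      = Matrix.fromCols (-(θ.Wy * θ.dev A c)) (0 : Matrix (Fin ry) (Fin ru) ℝ) *ᵥ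
        latent y u ω := fun ω => by
    have : -(θ.Wy * θ.dev A c) = θ.Wy * (aug c A - aug θ.bx θ.Wx) := by
      rw [Decoder.dev, ← Matrix.mul_neg, neg_sub]
    rw [this, aug_sub, mul_aug, fromCols_aug_latent, Decoder.epsY, hb]
    simp only [Matrix.mulVec_sub, Matrix.sub_mulVec, Matrix.mul_sub, hA, Matrix.zero_mulVec]
    abel
  simp only [e1]
  have i1 := integral_quadratic (δ := fun _ => 1) h.latent_memLp h.latent_moment
    (Matrix.fromCols (-(θ.Wy * θ.dev A c)) (0 : Matrix (Fin ry) (Fin ru) ℝ)) ((θ.sigmaY γ)⁻¹)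
  rw [integral_add i1.1 (integrable_const _), i1.2, Fintype.sum_sum_type]
  simp only [integral_const, probReal_univ, one_smul, one_mul]
  congr 1
  rw [Matrix.transpose_fromCols, Matrix.fromRows_mul, Matrix.fromRows_mul_fromCols]
  simp [Matrix.trace]

/-- On the feasible set the objective is an explicit function of the deviations of the
parameters from the ground truth. -/
theorem cycleLoss_eq (h : AffineSurjectiveModel μ x y u A B c D e) {p : Params rx ry rz} (γ : ℝ)
    (hA : p.1.Wy * A = 1) (hB : p.1.Wy * B = 0) (hb : p.1.b_y = -(p.1.Wy *ᵥ c)) :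
    cycleLoss (μ.map x) (μ.map y) γ p
      = core γ B p.1.Wy (p.1.dev A c) (p.2.resp A c) p.1.Vx p.2.Wz p.2.s := by
  rw [cycleLoss, h.lossX_eq γ hA hB hb, h.lossY_eq γ hA hb, core]
  simp only [Fintype.card_fin]
  ring

end AffineSurjectiveModel

/-- Parameters with prescribed `Wy`, deviation `N`, encoder response `R`, `Vx = V`, encoder `K` on
the column space of `B`, and deviations `s`. Since `D A = 1` and `D B = 0`, the encoder matrix
`R D + K (1 - A D)` acts on `A` as the `y`-part of `R` and on `B` as `K`. -/
def lift (A : Matrix (Fin rx) (Fin ry) ℝ) (c : Fin rx → ℝ) (D : Matrix (Fin ry) (Fin rx) ℝ)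
    (Wy : Matrix (Fin ry) (Fin rx) ℝ)
    (a : Matrix (Fin rx) (Unit ⊕ Fin ry) ℝ × Matrix (Fin rz) (Unit ⊕ Fin ry) ℝ ×
      Matrix (Fin rx) (Fin rz) ℝ × Matrix (Fin rz) (Fin rx) ℝ × (Fin rz → ℝ)) :
    Params rx ry rz :=
  (⟨A + a.1.toCols₂, Wy, a.2.2.1, c + fun i => a.1 i (Sum.inl ()), -(Wy *ᵥ c)⟩,
   ⟨a.2.1.toCols₂ * D + a.2.2.2.1 * (1 - A * D),
    (fun i => a.2.1 i (Sum.inl ())) - (a.2.1.toCols₂ * D + a.2.2.2.1 * (1 - A * D)) *ᵥ c,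
    a.2.2.2.2⟩)

theorem continuous_lift (A : Matrix (Fin rx) (Fin ry) ℝ) (c : Fin rx → ℝ)
    (D : Matrix (Fin ry) (Fin rx) ℝ) (Wy : Matrix (Fin ry) (Fin rx) ℝ) :
    Continuous (lift (rz := rz) A c D Wy) := by
  refine Continuous.prodMk (continuous_induced_rng.2 ?_) (continuous_induced_rng.2 ?_)
  · simp only [Function.comp_def, Matrix.toCols₂]; fun_prop
  · simp only [Function.comp_def, Matrix.toCols₂]; fun_prop

theorem lift_dev (A : Matrix (Fin rx) (Fin ry) ℝ) (c : Fin rx → ℝ)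
    (D : Matrix (Fin ry) (Fin rx) ℝ) (Wy : Matrix (Fin ry) (Fin rx) ℝ) (a) :
    (lift (rz := rz) A c D Wy a).1.dev A c = a.1 := by
  rw [Decoder.dev, lift, aug_sub]
  ext i (j | j) <;> simp [aug, Matrix.toCols₂]

theorem lift_resp {A : Matrix (Fin rx) (Fin ry) ℝ} (c : Fin rx → ℝ)
    {D : Matrix (Fin ry) (Fin rx) ℝ} (hDA : D * A = 1) (Wy : Matrix (Fin ry) (Fin rx) ℝ) (a) :
    (lift (rz := rz) A c D Wy a).2.resp A c = a.2.1 := by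
  have : (a.2.1.toCols₂ * D + a.2.2.2.1 * (1 - A * D)) * A = a.2.1.toCols₂ := by
    rw [Matrix.add_mul, Matrix.mul_assoc, hDA, Matrix.mul_assoc, Matrix.sub_mul, Matrix.mul_assoc A,
      hDA]
    simp
  simp only [Encoder.resp, lift, this]
  ext i (j | j) <;> simp [aug, Matrix.toCols₂]

theorem lift_Wz_mul {A : Matrix (Fin rx) (Fin ry) ℝ} (c : Fin rx → ℝ)
    {D : Matrix (Fin ry) (Fin rx) ℝ} (hDB : D * B = 0) (Wy : Matrix (Fin ry) (Fin rx) ℝ) (a) :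
    (lift (rz := rz) A c D Wy a).2.Wz * B = a.2.2.2.1 * B := by
  simp only [lift]
  rw [Matrix.add_mul, Matrix.mul_assoc, hDB, Matrix.mul_assoc, Matrix.sub_mul, Matrix.mul_assoc A,
      hDB]
  simp

theorem lift_self {A : Matrix (Fin rx) (Fin ry) ℝ} {c : Fin rx → ℝ}
    (D : Matrix (Fin ry) (Fin rx) ℝ) {p : Params rx ry rz} (hb : p.1.b_y = -(p.1.Wy *ᵥ c)) :
    lift A c D p.1.Wy (p.1.dev A c, p.2.resp A c, p.1.Vx, p.2.Wz, p.2.s) = p := by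
  have h1 : (p.2.resp A c).toCols₂ * D + p.2.Wz * (1 - A * D) = p.2.Wz := by
    have : (p.2.resp A c).toCols₂ = p.2.Wz * A := by
      ext; simp [Encoder.resp, aug, Matrix.toCols₂]
    rw [this, Matrix.mul_sub, Matrix.mul_assoc]; simp
  rw [lift]
  refine Prod.ext (Decoder.ext ?_ rfl rfl ?_ hb.symm) (Encoder.ext h1 ?_ rfl)
  · ext; simp [Decoder.dev, aug, Matrix.toCols₂]
  · ext; simp [Decoder.dev, aug]
  · simp only [h1]
    ext; simp [Encoder.resp, aug]

namespace AffineSurjectiveModel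

theorem lift_mem_feasible (h : AffineSurjectiveModel μ x y u A B c D e)
    {Wy : Matrix (Fin ry) (Fin rx) ℝ} (hA : Wy * A = 1) (hB : Wy * B = 0)
    {a : Matrix (Fin rx) (Unit ⊕ Fin ry) ℝ × Matrix (Fin rz) (Unit ⊕ Fin ry) ℝ ×
      Matrix (Fin rx) (Fin rz) ℝ × Matrix (Fin rz) (Fin rx) ℝ × (Fin rz → ℝ)}
    (hs : ∀ k, a.2.2.2.2 k ≠ 0) : lift A c D Wy a ∈ feasible rz (μ.map x) (μ.map y) :=
  (h.feasible_iff _).2 ⟨hs, hA, hB, rfl⟩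

theorem cycleLoss_lift (h : AffineSurjectiveModel μ x y u A B c D e) (γ : ℝ)
    {Wy : Matrix (Fin ry) (Fin rx) ℝ} (hA : Wy * A = 1) (hB : Wy * B = 0)
    (a : Matrix (Fin rx) (Unit ⊕ Fin ry) ℝ × Matrix (Fin rz) (Unit ⊕ Fin ry) ℝ ×
      Matrix (Fin rx) (Fin rz) ℝ × Matrix (Fin rz) (Fin rx) ℝ × (Fin rz → ℝ)) :
    cycleLoss (μ.map x) (μ.map y) γ (lift A c D Wy a)
      = core γ B Wy a.1 a.2.1 a.2.2.1 a.2.2.2.1 a.2.2.2.2 := by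
  rw [h.cycleLoss_eq γ hA hB rfl, lift_dev, lift_resp c h.D_mul_A, core, core,
    lift_Wz_mul c h.D_mul_B]
  rfl

/-- Pulling the cycle loss back along the continuous map `lift` turns a constrained local minimum
into an unconstrained one of `core`. -/
theorem core_local (h : AffineSurjectiveModel μ x y u A B c D e) {γ : ℝ} {p : Params rx ry rz}
    (hp : IsLocalMinimizer (μ.map x) (μ.map y) γ p) :
    IsLocalMin (fun a : Matrix (Fin rx) (Unit ⊕ Fin ry) ℝ × Matrix (Fin rz) (Unit ⊕ Fin ry) ℝ ×
      Matrix (Fin rx) (Fin rz) ℝ × Matrix (Fin rz) (Fin rx) ℝ × (Fin rz → ℝ) =>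
      core γ B p.1.Wy a.1 a.2.1 a.2.2.1 a.2.2.2.1 a.2.2.2.2)
      (p.1.dev A c, p.2.resp A c, p.1.Vx, p.2.Wz, p.2.s) := by
  obtain ⟨hs, hA, hB, hb⟩ := (h.feasible_iff p).1 hp.1
  have hself := lift_self (A := A) D hb
  have h1 := eventually_nhdsWithin_iff.1 hp.2
  have hcont := (continuous_lift (rz := rz) A c D p.1.Wy).tendsto
    (p.1.dev A c, p.2.resp A c, p.1.Vx, p.2.Wz, p.2.s)
  rw [hself] at hcont
  have hs' : ∀ᶠ a : Matrix (Fin rx) (Unit ⊕ Fin ry) ℝ × Matrix (Fin rz) (Unit ⊕ Fin ry) ℝ ×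
      Matrix (Fin rx) (Fin rz) ℝ × Matrix (Fin rz) (Fin rx) ℝ × (Fin rz → ℝ) in
      𝓝 (p.1.dev A c, p.2.resp A c, p.1.Vx, p.2.Wz, p.2.s), ∀ k, a.2.2.2.2 k ≠ 0 := by
    rw [eventually_all]
    intro k
    have : Continuous fun a : Matrix (Fin rx) (Unit ⊕ Fin ry) ℝ ×
      Matrix (Fin rz) (Unit ⊕ Fin ry) ℝ ×
      Matrix (Fin rx) (Fin rz) ℝ × Matrix (Fin rz) (Fin rx) ℝ × (Fin rz → ℝ) => a.2.2.2.2 k := by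
      fun_prop
    exact this.continuousAt.eventually_ne (hs k)
  filter_upwards [hcont.eventually h1, hs'] with a ha has
  have := ha (h.lift_mem_feasible hA hB has)
  rw [h.cycleLoss_lift γ hA hB, h.cycleLoss_eq γ hA hB hb] at this
  exact this

end AffineSurjectiveModel

end CycleCVAE

/-! ### Minima of the cycle loss -/

namespace CycleCVAE

set_option linter.unusedSectionVars false

/-- All terms of the objective besides the linear VAE are bounded below by their values at
`N = 0`, `R = 0`, `Wy V = 0`. -/
theorem core_ge {m n k u e : Type*} [Fintype m] [Fintype n] [Fintype k] [Fintype u] [Fintype e]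
    [DecidableEq m] [DecidableEq k] {γ : ℝ} (hγ : 0 < γ) (B : Matrix n u ℝ) (Wy : Matrix m n ℝ)
    (N : Matrix n e ℝ) (R : Matrix k e ℝ) (V : Matrix n k ℝ) (K : Matrix k n ℝ) (s : k → ℝ) :
    vae γ B V (K * B) s + (Fintype.card n + Fintype.card m) * Real.log γ
      ≤ core γ B Wy N R V K s := by
  have hT := posSemidef_sandwich Wy V
  have h1 := card_mul_log_le_log_det hγ hT
  have h2 := trace_quadratic_nonneg (posDef_smul_one_add hγ hT).inv.posSemidef (Wy * N)
  have h3 := mul_nonneg (inv_pos.2 hγ).le (frob_nonneg (N + V * R))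
  have h4 := frob_nonneg R
  rw [core]
  linarith

theorem span_col_le {n k u : Type*} [Fintype k] [Fintype u] {V : Matrix n k ℝ} {B : Matrix n u ℝ}
    {Z : Matrix u k ℝ} (h : V = B * Z) :
    Submodule.span ℝ (Set.range V.col) ≤ Submodule.span ℝ (Set.range B.col) := by
  rw [← Matrix.range_mulVecLin, ← Matrix.range_mulVecLin, h, Matrix.mulVecLin_mul]
  exact LinearMap.range_comp_le_range _ _

theorem rank_le_of_eq_mul {n k u : Type*} [Fintype n] [Fintype k] [Fintype u] {V : Matrix n k ℝ}
    {B : Matrix n u ℝ} {Z : Matrix u k ℝ} (h : V = B * Z) : V.rank ≤ B.rank := by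
  rw [h]; exact Matrix.rank_mul_le_left _ _

/-- A matrix `V` with orthogonal columns has exactly `rank V` many nonzero columns, so a permutation
of its columns brings it to the form `[B̃, 0]`. -/
theorem exists_padCols {rx rz ru : ℕ} {V : Matrix (Fin rx) (Fin rz) ℝ}
    {B : Matrix (Fin rx) (Fin ru) ℝ} (ho : ∀ i j, i ≠ j → (Vᵀ * V) i j = 0)
    {Z₀ : Matrix (Fin ru) (Fin rz) ℝ} (hV : V = B * Z₀)
    {Z : Matrix (Fin rz) (Fin ru) ℝ} (hB : B = V * Z) :
    B.rank ≤ rz ∧ ∃ (Bt : Matrix (Fin rx) (Fin B.rank) ℝ) (σ : Equiv.Perm (Fin rz)),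
      Submodule.span ℝ (Set.range Bt.col) = Submodule.span ℝ (Set.range B.col) ∧
      V = padCols Bt rz * σ.permMatrix ℝ := by
  have hspan : Submodule.span ℝ (Set.range V.col) = Submodule.span ℝ (Set.range B.col) :=
    le_antisymm (span_col_le hV) (span_col_le hB)
  have hcard : Fintype.card {i // (Vᵀ * V) i i ≠ 0} = B.rank :=
    (card_gram_ne_zero ho).trans (le_antisymm (rank_le_of_eq_mul hV) (rank_le_of_eq_mul hB))
  have hr : B.rank ≤ rz := by
    rw [← hcard]
    simpa only [Fintype.card_fin] using Fintype.card_subtype_le fun i => (Vᵀ * V) i i ≠ 0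
  let e₀ : {i // (Vᵀ * V) i i ≠ 0} ≃ Fin B.rank := Fintype.equivFinOfCardEq hcard
  let e₁ : Fin B.rank ≃ {j : Fin rz // (j : ℕ) < B.rank} :=
    { toFun := fun i => ⟨⟨i, i.2.trans_le hr⟩, i.2⟩
      invFun := fun j => ⟨j.1, j.2⟩
      left_inv := fun _ => rfl
      right_inv := fun _ => rfl }
  let σ : Equiv.Perm (Fin rz) := (e₀.trans e₁).extendSubtype
  -- `σ` moves the nonzero columns to the front, and `Bt` lists them in the new order
  let Bt : Matrix (Fin rx) (Fin B.rank) ℝ := Matrix.of fun i j => V i (e₀.symm j)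
  have hzero : ∀ k, (Vᵀ * V) k k = 0 → ∀ i, V i k = 0 := by
    intro k hk i
    rw [← frob_mul_single] at hk
    have := congrFun (congrFun (frob_eq_zero.1 hk) i) ()
    simpa using this
  refine ⟨hr, Bt, σ⁻¹, ?_, ?_⟩
  · rw [← hspan]
    refine le_antisymm (Submodule.span_le.2 ?_) (Submodule.span_le.2 ?_)
    · rintro _ ⟨j, rfl⟩
      exact Submodule.subset_span ⟨e₀.symm j, rfl⟩
    · rintro _ ⟨k, rfl⟩
      by_cases hk : (Vᵀ * V) k k = 0
      · have : V.col k = 0 := funext fun i => hzero k hk i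
        rw [this]; exact Submodule.zero_mem _
      · refine Submodule.subset_span ⟨e₀ ⟨k, hk⟩, ?_⟩
        ext i
        simp [Bt]
  · ext i k
    have hmul : (padCols Bt rz * (σ⁻¹).permMatrix ℝ) i k = padCols Bt rz i (σ k) := by
      have := congrFun (Matrix.vecMul_permMatrix (R := ℝ) (σ := σ⁻¹) (v := padCols Bt rz i)) k
      exact this
    rw [hmul, padCols, Matrix.of_apply]
    by_cases hk : (Vᵀ * V) k k = 0
    · have : ¬ ((σ k : Fin rz) : ℕ) < B.rank :=
        (e₀.trans e₁).extendSubtype_not_mem k (not_not.2 hk)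
      rw [dif_neg this, hzero k hk]
    · have hσ : σ k = (e₁ (e₀ ⟨k, hk⟩) : Fin rz) :=
        (e₀.trans e₁).extendSubtype_apply_of_mem k hk
      have hlt : ((σ k : Fin rz) : ℕ) < B.rank := by rw [hσ]; exact (e₁ (e₀ ⟨k, hk⟩)).2
      rw [dif_pos hlt]
      have : (⟨(σ k : Fin rz), hlt⟩ : Fin B.rank) = e₀ ⟨k, hk⟩ := by
        apply Fin.ext
        simp [hσ, e₁]
      rw [this]
      simp [Bt]

variable {Ω : Type*} [MeasurableSpace Ω] {μ : Measure Ω} [IsProbabilityMeasure μ]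
    {rx ry rz ru : ℕ} {x : Ω → Fin rx → ℝ} {y : Ω → Fin ry → ℝ} {u : Ω → Fin ru → ℝ}
    {A : Matrix (Fin rx) (Fin ry) ℝ} {B : Matrix (Fin rx) (Fin ru) ℝ} {c : Fin rx → ℝ}
    {D : Matrix (Fin ry) (Fin rx) ℝ} {e : Fin ry → ℝ}

theorem IsGlobalMinimizer.isLocalMinimizer {ρx : Measure (Fin rx → ℝ)} {ρy : Measure (Fin ry → ℝ)}
    {γ : ℝ} {p : Params rx ry rz} (h : IsGlobalMinimizer ρx ρy γ p) :
    IsLocalMinimizer ρx ρy γ p := by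
  refine ⟨h.1, ?_⟩
  filter_upwards [self_mem_nhdsWithin] with q hq using h.2 hq

namespace AffineSurjectiveModel

theorem secondMoment_eq (h : AffineSurjectiveModel μ x y u A B c D e) :
    secondMoment (μ.map x)
      = Matrix.fromCols (aug c A) B * (Matrix.fromCols (aug c A) B)ᵀ := by
  ext i j
  have hm : Continuous fun v : Fin rx → ℝ => v i * v j := by fun_prop
  obtain ⟨G, hG⟩ : ∃ G, G = Matrix.fromCols (aug c A) B := ⟨_, rfl⟩
  rw [secondMoment, Matrix.of_apply, integral_map h.aemeasurable_x hm.aestronglyMeasurable, ← hG]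
  have h1 := (integral_quadratic (δ := fun _ => 1) h.latent_memLp h.latent_moment G
    (Matrix.single i j 1)).2
  -- the entry `(i, j)` is the quadratic form of an elementary matrix
  have h2 : ∫ ω, x ω i * x ω j ∂μ
      = ∫ ω, (G *ᵥ latent y u ω) ⬝ᵥ (Matrix.single i j 1 *ᵥ (G *ᵥ latent y u ω)) ∂μ := by
    refine integral_congr_ae ?_
    filter_upwards [h.x_eq_latent] with ω hω
    rw [hω, ← hG]
    simp [dotProduct, Matrix.mulVec, Matrix.single_apply, ite_and]
  rw [h2, h1, Matrix.mul_apply]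
  refine Finset.sum_congr rfl fun l _ => ?_
  rw [one_mul, Matrix.mul_assoc, Matrix.mul_apply]
  simp [Matrix.mul_apply, Matrix.single_apply, ite_and]

/-- The hypothesis on `rz` leaves room for `rank B` latent coordinates: as `D A = I` and `D B = 0`,
the column spaces of `A` and `B` are independent, and both lie in the range of `E[x xᵀ]`. -/
theorem rank_le (h : AffineSurjectiveModel μ x y u A B c D e)
    (hrz : (rz : ℤ) ≥ ((secondMoment (μ.map x)).rank : ℤ) - (ry : ℤ)) : B.rank ≤ rz := by
  have h1 : ry + B.rank ≤ (secondMoment (μ.map x)).rank := by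
    rw [h.secondMoment_eq, Matrix.rank_self_mul_transpose]
    have hdis : LinearMap.range A.mulVecLin ⊓ LinearMap.range B.mulVecLin = ⊥ := by
      rw [eq_bot_iff]
      rintro _ ⟨⟨a, rfl⟩, ⟨b, hb⟩⟩
      have hb' : B *ᵥ b = A *ᵥ a := hb
      have : D *ᵥ (B *ᵥ b) = D *ᵥ (A *ᵥ a) := by rw [hb']
      rw [Matrix.mulVec_mulVec, Matrix.mulVec_mulVec, h.D_mul_A, h.D_mul_B] at this
      have ha : a = 0 := by simpa using this.symm
      simp [ha]
    have hsum := Submodule.finrank_sup_add_finrank_inf_eq (LinearMap.range A.mulVecLin)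
      (LinearMap.range B.mulVecLin)
    rw [hdis, finrank_bot, add_zero] at hsum
    have hA : Module.finrank ℝ (LinearMap.range A.mulVecLin) = ry := h.rank_A
    have hBr : Module.finrank ℝ (LinearMap.range B.mulVecLin) = B.rank := rfl
    rw [hA, hBr] at hsum
    rw [← hsum]
    refine Submodule.finrank_mono (sup_le ?_ ?_)
    · rintro _ ⟨a, rfl⟩
      refine ⟨Sum.elim (Sum.elim 0 a) 0, ?_⟩
      ext i
      simp [aug, Matrix.mulVec, dotProduct, Fintype.sum_sum_type]
    · rintro _ ⟨b, rfl⟩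
      refine ⟨Sum.elim 0 b, ?_⟩
      ext i
      simp [Matrix.mulVec, dotProduct, Fintype.sum_sum_type]
  omega

theorem optimal_of_local (h : AffineSurjectiveModel μ x y u A B c D e) (hr : B.rank ≤ rz) {γ : ℝ}
    (hγ : 0 < γ) {p : Params rx ry rz} (hp : IsLocalMinimizer (μ.map x) (μ.map y) γ p) :
    p.1.dev A c = 0 ∧ p.2.resp A c = 0 ∧ IsOpt γ B p.1.Vx (p.2.Wz * B) p.2.s := by
  obtain ⟨hs, hA, hB, hb⟩ := (h.feasible_iff p).1 hp.1
  have h1 := h.core_local hp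
  obtain ⟨hN, hR⟩ := core_local_centered hγ h1
  rw [hN, hR] at h1
  have hrange := core_local_range hγ hB hs h1
  have hV : p.1.Wy * p.1.Vx = 0 := by
    obtain ⟨Z, hZ⟩ := hrange
    rw [hZ, ← Matrix.mul_assoc, hB, Matrix.zero_mul]
  exact ⟨hN, hR, isOpt_of_vae_local hγ hB (by simpa using hr) hrange hs
    (vae_local_of_core_local hV h1)⟩

/-- The value at a centered point that is optimal for some noise level `γ'`, evaluated at any noise
level `γ`. -/
theorem cycleLoss_of_optimal (h : AffineSurjectiveModel μ x y u A B c D e) {γ γ' : ℝ}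
    {p : Params rx ry rz} (hp : p ∈ feasible rz (μ.map x) (μ.map y)) (hN : p.1.dev A c = 0)
    (hR : p.2.resp A c = 0) (ho : IsOpt γ' B p.1.Vx (p.2.Wz * B) p.2.s) :
    cycleLoss (μ.map x) (μ.map y) γ p
      = vae γ B p.1.Vx (p.2.Wz * B) p.2.s + (rx + ry) * Real.log γ := by
  obtain ⟨hs, hA, hB, hb⟩ := (h.feasible_iff p).1 hp
  have hV : p.1.Wy * p.1.Vx = 0 := by
    obtain ⟨Z, hZ⟩ := ho.range
    rw [hZ, ← Matrix.mul_assoc, hB, Matrix.zero_mul]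
  rw [h.cycleLoss_eq γ hA hB hb, hN, hR, core_centered_of_mul_eq_zero γ B hV]
  simp

/-- `core_ge` and `IsOpt.vae_le` bound the loss of any feasible point below by that of an optimal
one. -/
theorem global_of_optimal (h : AffineSurjectiveModel μ x y u A B c D e) {γ : ℝ} (hγ : 0 < γ)
    {p : Params rx ry rz} (hp : p ∈ feasible rz (μ.map x) (μ.map y)) (hN : p.1.dev A c = 0)
    (hR : p.2.resp A c = 0) (ho : IsOpt γ B p.1.Vx (p.2.Wz * B) p.2.s) :
    IsGlobalMinimizer (μ.map x) (μ.map y) γ p := by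
  refine ⟨hp, fun q hq => ?_⟩
  obtain ⟨hs, hA, hB, hb⟩ := (h.feasible_iff q).1 hq
  change cycleLoss (μ.map x) (μ.map y) γ p ≤ cycleLoss (μ.map x) (μ.map y) γ q
  rw [h.cycleLoss_of_optimal hp hN hR ho, h.cycleLoss_eq γ hA hB hb]
  have h1 := core_ge hγ B q.1.Wy (q.1.dev A c) (q.2.resp A c) q.1.Vx q.2.Wz q.2.s
  have h2 := ho.vae_le hγ q.1.Vx (q.2.Wz * B) hs
  simp only [Fintype.card_fin] at h1
  linarith

theorem exists_global (h : AffineSurjectiveModel μ x y u A B c D e) (hr : B.rank ≤ rz) {γ : ℝ}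
    (hγ : 0 < γ) : ∃ p : Params rx ry rz, IsGlobalMinimizer (μ.map x) (μ.map y) γ p := by
  obtain ⟨V, K, s, hs, ho⟩ := exists_isOpt (k := Fin rz) hγ B (by simpa using hr)
  refine ⟨lift A c D D (0, 0, V, K, s), h.global_of_optimal hγ
    (h.lift_mem_feasible h.D_mul_A h.D_mul_B hs) (lift_dev _ _ _ _ _)
    (lift_resp _ h.D_mul_A _ _) ?_⟩
  rw [lift_Wz_mul c h.D_mul_B]
  exact ho

theorem dev_eq_zero {θ : Decoder rx ry rz} (hN : θ.dev A c = 0) : θ.Wx = A ∧ θ.bx = c := by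
  constructor
  · ext i j
    have := congrFun (congrFun hN i) (Sum.inr j)
    simpa [Decoder.dev, aug, sub_eq_zero] using this
  · ext i
    have := congrFun (congrFun hN i) (Sum.inl ())
    simpa [Decoder.dev, aug, sub_eq_zero] using this

theorem recovers_of_optimal (h : AffineSurjectiveModel μ x y u A B c D e) {γ : ℝ}
    {L : Matrix (Fin rx) (Fin ru) ℝ} (hL : L * Bᵀ * B = B) (hsmall : γ * frob L < 1)
    {p : Params rx ry rz} (hp : p ∈ feasible rz (μ.map x) (μ.map y)) (hN : p.1.dev A c = 0)
    (ho : IsOpt γ B p.1.Vx (p.2.Wz * B) p.2.s) : Recovers p.1 A B c := by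
  obtain ⟨-, hA, hB, hb⟩ := (h.feasible_iff p).1 hp
  obtain ⟨Z, hZ⟩ := ho.exists_eq_mul hL hsmall
  obtain ⟨Z₀, hZ₀⟩ := ho.range
  obtain ⟨hWx, hbx⟩ := dev_eq_zero hN
  exact ⟨hWx, exists_padCols ho.orth hZ₀ hZ, hbx, p.1.Wy, hA, hB, rfl, hb⟩

end AffineSurjectiveModel

theorem continuous_decoder : Continuous fun θ : Decoder rx ry rz =>
    (θ.Wx, θ.Wy, θ.Vx, θ.bx, θ.b_y) := continuous_induced_dom

/-- The joint problem has no critical point in `γ`: the reconstruction error of an optimum is at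
most `rx γ`, whereas stationarity in `γ` requires `(rx + ry) γ`. -/
theorem AffineSurjectiveModel.not_joint_local (h : AffineSurjectiveModel μ x y u A B c D e)
    (hr : B.rank ≤ rz) (hry : 0 < ry) (p : Params rx ry rz) (γ : ℝ) :
    ¬ IsJointLocalMinimizer (μ.map x) (μ.map y) p γ := by
  rintro ⟨hp, hγ, hmin⟩
  have hmin' := eventually_nhdsWithin_iff.1 hmin
  have hloc : IsLocalMinimizer (μ.map x) (μ.map y) γ p := by
    refine ⟨hp, ?_⟩
    have hc : Tendsto (fun q : Params rx ry rz => (q, γ)) (𝓝 p) (𝓝 (p, γ)) :=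
      (Continuous.prodMk_left γ).tendsto p
    refine eventually_nhdsWithin_iff.2 ?_
    filter_upwards [hc.eventually hmin'] with q hq hqf
    exact hq ⟨hqf, hγ⟩
  obtain ⟨hN, hR, ho⟩ := h.optimal_of_local hr hγ hloc
  obtain ⟨E, hE⟩ : ∃ E, E = frob (B - p.1.Vx * (p.2.Wz * B))
    + frob (p.1.Vx * Matrix.diagonal p.2.s) := ⟨_, rfl⟩
  have hmin1 : IsLocalMin (fun t : ℝ => t⁻¹ * E + (rx + ry) * Real.log t) γ := by
    have hc : Tendsto (fun t : ℝ => (p, t)) (𝓝 γ) (𝓝 (p, γ)) :=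
      (Continuous.prodMk_right p).tendsto γ
    filter_upwards [hc.eventually hmin', lt_mem_nhds hγ] with t ht ht0
    have := ht ⟨hp, ht0⟩
    simp only [h.cycleLoss_of_optimal hp hN hR ho, vae, ← hE] at this
    linarith
  have hd : HasDerivAt (fun t : ℝ => t⁻¹ * E + (rx + ry) * Real.log t)
      (-(γ ^ 2)⁻¹ * E + (rx + ry) * γ⁻¹) γ :=
    ((hasDerivAt_inv hγ.ne').mul_const E).fun_add ((Real.hasDerivAt_log hγ.ne').const_mul _)
  have h0 := hmin1.hasDerivAt_eq_zero hd
  have h1 : γ⁻¹ * E ≤ rx := by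
    have := ho.trace_inv_le hγ
    rw [← ho.recon_eq hγ, ← hE] at this
    simpa using this
  have h2 : γ⁻¹ * E = rx + ry := by
    field_simp at h0 ⊢
    linarith
  have : (0 : ℝ) < ry := by exact_mod_cast hry
  linarith

/-- An explicit upper bound for the optimal value, of order `2 ry log γ` as `γ → 0`. -/
theorem AffineSurjectiveModel.cycleLoss_le (h : AffineSurjectiveModel μ x y u A B c D e)
    (hr : B.rank ≤ rz) {γ : ℝ} (hγ : 0 < γ) (hγ1 : γ < 1) {p : Params rx ry rz}
    (hp : IsGlobalMinimizer (μ.map x) (μ.map y) γ p) :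
    cycleLoss (μ.map x) (μ.map y) γ p
      ≤ 2 * ry * Real.log γ + (rx + rz + rz * Real.log (1 + frob B)) := by
  obtain ⟨hN, hR, ho⟩ := h.optimal_of_local hr hγ hp.isLocalMinimizer
  rw [h.cycleLoss_of_optimal hp.1 hN hR ho, ho.vae_eq hγ]
  have h1 := ho.trace_inv_le hγ
  obtain ⟨d, hd⟩ : ∃ d : Fin rz → ℝ, d = fun i => (p.1.Vxᵀ * p.1.Vx) i i := ⟨_, rfl⟩
  have hd' : ∀ i, (p.1.Vxᵀ * p.1.Vx) i i = d i := fun i => by rw [hd]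
  have hlogγ : Real.log γ < 0 := Real.log_neg hγ hγ1
  have hfB := frob_nonneg B
  have hlogB : 0 ≤ Real.log (1 + frob B) := Real.log_nonneg (by linarith)
  have hcard : (Fintype.card {i // d i ≠ 0} : ℝ) ≤ rx - ry := by
    have e1 : Fintype.card {i // d i ≠ 0} = p.1.Vx.rank := by
      rw [hd]; exact card_gram_ne_zero ho.orth
    obtain ⟨Z, hZ⟩ := ho.range
    have e2 := rank_le_of_eq_mul hZ
    have e3 := h.rank_B
    have e4 := h.ry_lt_rx
    have : Fintype.card {i // d i ≠ 0} + ry ≤ rx := by omega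
    have : ((Fintype.card {i // d i ≠ 0} + ry : ℕ) : ℝ) ≤ rx := by exact_mod_cast this
    push_cast at this
    linarith
  have hsum : ∑ i, Real.log (1 + γ⁻¹ * d i)
      ≤ rz * Real.log (1 + frob B) - Fintype.card {i // d i ≠ 0} * Real.log γ := by
    have e1 : ∀ i, Real.log (1 + γ⁻¹ * d i)
        ≤ Real.log (1 + frob B) + if d i ≠ 0 then - Real.log γ else 0 := fun i => by
      by_cases hi : d i = 0
      · simp [hi, hlogB]
      · have h2 := ho.shifted_gram_le (i := i) (by rw [hd']; exact hi)
        rw [hd'] at h2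
        have hdi : 0 ≤ d i := by rw [← hd']; exact gram_diag_nonneg _ _
        have e3 : 1 + γ⁻¹ * d i = (γ + d i) * γ⁻¹ := by field_simp
        rw [if_pos hi, e3, Real.log_mul (by positivity) (by positivity), Real.log_inv]
        have := Real.log_le_log (show 0 < γ + d i by positivity) (h2.trans (by linarith :
          frob B ≤ 1 + frob B))
        linarith
    refine (Finset.sum_le_sum fun i _ => e1 i).trans ?_
    rw [Finset.sum_add_distrib, ← Finset.sum_filter, Finset.sum_const, Finset.sum_const,
      ← Fintype.card_subtype]
    simp
  simp only [hd'] at *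
  simp only [Fintype.card_fin] at h1 ⊢
  nlinarith

end CycleCVAE

open CycleCVAE in
theorem proposition2 {Ω : Type*} [MeasurableSpace Ω] (μ : Measure Ω) [IsProbabilityMeasure μ]
    (rx ry rz ru : ℕ)
    (x : Ω → Fin rx → ℝ) (y : Ω → Fin ry → ℝ) (u : Ω → Fin ru → ℝ)
    (A : Matrix (Fin rx) (Fin ry) ℝ) (B : Matrix (Fin rx) (Fin ru) ℝ) (c : Fin rx → ℝ)
    (D : Matrix (Fin ry) (Fin rx) ℝ) (e : Fin ry → ℝ)
    (hmodel : CycleCVAE.AffineSurjectiveModel μ x y u A B c D e)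
    (ρx : Measure (Fin rx → ℝ)) (hρx : ρx = μ.map x)
    (ρy : Measure (Fin ry → ℝ)) (hρy : ρy = μ.map y)
    (hrz : (rz : ℤ) ≥ ((CycleCVAE.secondMoment ρx).rank : ℤ) - (ry : ℤ)) :
    -- at every noise level there are global minima, and every local minimum is a global one
    (∀ γ : ℝ, 0 < γ →
      (∃ p : CycleCVAE.Params rx ry rz, CycleCVAE.IsGlobalMinimizer ρx ρy γ p) ∧
      (∀ p : CycleCVAE.Params rx ry rz, CycleCVAE.IsLocalMinimizer ρx ρy γ p →
        CycleCVAE.IsGlobalMinimizer ρx ρy γ p)) ∧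
    -- at every sufficiently small noise level, the minima have the stated form
    (∃ γ₀ : ℝ, 0 < γ₀ ∧ ∀ γ : ℝ, 0 < γ → γ < γ₀ →
      ∀ p : CycleCVAE.Params rx ry rz, CycleCVAE.IsGlobalMinimizer ρx ρy γ p →
        CycleCVAE.Recovers p.1 A B c) ∧
    -- along every sequence of minima with `γ → 0`, `Vx Vxᵀ → B Bᵀ`, and limits have the stated form
    (∀ (γ : ℕ → ℝ) (p : ℕ → CycleCVAE.Params rx ry rz), (∀ n, 0 < γ n) →
      Tendsto γ atTop (𝓝 0) → (∀ n, CycleCVAE.IsGlobalMinimizer ρx ρy (γ n) (p n)) →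
        Tendsto (fun n => (p n).1.Vx * (p n).1.Vxᵀ) atTop (𝓝 (B * Bᵀ)) ∧
        ∀ θ : CycleCVAE.Decoder rx ry rz, Tendsto (fun n => (p n).1) atTop (𝓝 θ) →
          CycleCVAE.Recovers θ A B c) ∧
    -- when `γ` is trained too, no local minimum has `γ > 0`, and the optimal value tends to `-∞`
    -- as `γ → 0`
    (0 < ry →
      (∀ (p : CycleCVAE.Params rx ry rz) (γ : ℝ),
        ¬ CycleCVAE.IsJointLocalMinimizer ρx ρy p γ) ∧
      (∀ M : ℝ, ∃ γ₀ : ℝ, 0 < γ₀ ∧ ∀ γ : ℝ, 0 < γ → γ < γ₀ →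
        ∀ p : CycleCVAE.Params rx ry rz, CycleCVAE.IsGlobalMinimizer ρx ρy γ p →
          CycleCVAE.cycleLoss ρx ρy γ p < M)) := by
  subst hρx hρy
  have hr := hmodel.rank_le hrz
  obtain ⟨L, hL⟩ := exists_left_recover B
  have hL0 := frob_nonneg L
  refine ⟨fun γ hγ => ⟨hmodel.exists_global hr hγ, fun p hp => ?_⟩, ?_, ?_, fun hry => ⟨?_, ?_⟩⟩
  · obtain ⟨hN, hR, ho⟩ := hmodel.optimal_of_local hr hγ hp
    exact hmodel.global_of_optimal hγ hp.1 hN hR ho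
  · refine ⟨(1 + frob L)⁻¹, by positivity, fun γ hγ hlt p hp => ?_⟩
    obtain ⟨hN, hR, ho⟩ := hmodel.optimal_of_local hr hγ hp.isLocalMinimizer
    -- `frob L` bounds the inverse of the smallest nonzero eigenvalue of `B Bᵀ`
    refine hmodel.recovers_of_optimal hL ?_ hp.1 hN ho
    have h1 : γ * (1 + frob L) < 1 := by
      rw [lt_inv_comm₀ hγ (by positivity)] at hlt
      calc γ * (1 + frob L) < γ * γ⁻¹ := mul_lt_mul_of_pos_left hlt hγ
        _ = 1 := mul_inv_cancel₀ hγ.ne'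
    nlinarith
  · intro γ p hγ hlim hp
    have hopt := fun n => hmodel.optimal_of_local hr (hγ n) (hp n).isLocalMinimizer
    obtain ⟨Y, hY⟩ := exists_normal_eq B (1 : Matrix (Fin rx) (Fin rx) ℝ)
    rw [Matrix.mul_one] at hY
    have hVV : Tendsto (fun n => (p n).1.Vx * (p n).1.Vxᵀ) atTop (𝓝 (B * Bᵀ)) := by
      have h1 : Tendsto (fun n => B * Bᵀ - γ n • (B * Y)) atTop (𝓝 (B * Bᵀ)) := by
        simpa using tendsto_const_nhds.sub (hlim.smul_const (B * Y))
      have h2 : ∀ᶠ n in atTop, γ n * frob L < 1 := by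
        have := hlim.mul_const (frob L)
        rw [zero_mul] at this
        exact this.eventually_lt_const one_pos
      refine h1.congr' ?_
      filter_upwards [h2] with n hn
      obtain ⟨-, -, ho⟩ := hopt n
      obtain ⟨Z, hZ⟩ := ho.exists_eq_mul hL hn
      exact (ho.mul_transpose_eq hZ hY).symm
    refine ⟨hVV, fun θ hθ => ?_⟩
    have hcomp := (continuous_decoder.tendsto θ).comp hθ
    have tWx : Tendsto (fun n => (p n).1.Wx) atTop (𝓝 θ.Wx) :=
      (continuous_fst.tendsto _).comp hcomp
    have hcomp2 := (continuous_snd.tendsto _).comp hcomp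
    have tWy : Tendsto (fun n => (p n).1.Wy) atTop (𝓝 θ.Wy) :=
      (continuous_fst.tendsto _).comp hcomp2
    have hcomp3 := (continuous_snd.tendsto _).comp hcomp2
    have tVx : Tendsto (fun n => (p n).1.Vx) atTop (𝓝 θ.Vx) :=
      (continuous_fst.tendsto _).comp hcomp3
    have hcomp4 := (continuous_snd.tendsto _).comp hcomp3
    have tbx : Tendsto (fun n => (p n).1.bx) atTop (𝓝 θ.bx) :=
      (continuous_fst.tendsto _).comp hcomp4
    have tby : Tendsto (fun n => (p n).1.b_y) atTop (𝓝 θ.b_y) :=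
      (continuous_snd.tendsto _).comp hcomp4
    have hfeas := fun n => (hmodel.feasible_iff (p n)).1 (hp n).1
    have hWx : θ.Wx = A := by
      refine tendsto_nhds_unique tWx (tendsto_const_nhds.congr fun n => ?_)
      exact (AffineSurjectiveModel.dev_eq_zero (hopt n).1).1.symm
    have hbx : θ.bx = c := by
      refine tendsto_nhds_unique tbx (tendsto_const_nhds.congr fun n => ?_)
      exact (AffineSurjectiveModel.dev_eq_zero (hopt n).1).2.symm
    have hWyA : θ.Wy * A = 1 := by
      have hc : Continuous fun W : Matrix (Fin ry) (Fin rx) ℝ => W * A := by fun_prop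
      refine tendsto_nhds_unique ((hc.tendsto _).comp tWy) (tendsto_const_nhds.congr fun n => ?_)
      exact (hfeas n).2.1.symm
    have hWyB : θ.Wy * B = 0 := by
      have hc : Continuous fun W : Matrix (Fin ry) (Fin rx) ℝ => W * B := by fun_prop
      refine tendsto_nhds_unique ((hc.tendsto _).comp tWy) (tendsto_const_nhds.congr fun n => ?_)
      exact (hfeas n).2.2.1.symm
    have hby : θ.b_y = -(θ.Wy *ᵥ c) := by
      have hc : Continuous fun W : Matrix (Fin ry) (Fin rx) ℝ => -(W *ᵥ c) := by fun_prop
      refine tendsto_nhds_unique tby (((hc.tendsto _).comp tWy).congr fun n => ?_)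
      exact (hfeas n).2.2.2.symm
    have hVlim : θ.Vx * θ.Vxᵀ = B * Bᵀ := by
      have hc : Continuous fun W : Matrix (Fin rx) (Fin rz) ℝ => W * Wᵀ := by fun_prop
      exact tendsto_nhds_unique ((hc.tendsto _).comp tVx) hVV
    have ho : ∀ i j, i ≠ j → (θ.Vxᵀ * θ.Vx) i j = 0 := fun i j hij => by
      have hc : Continuous fun W : Matrix (Fin rx) (Fin rz) ℝ => (Wᵀ * W) i j := by fun_prop
      refine tendsto_nhds_unique ((hc.tendsto _).comp tVx) (tendsto_const_nhds.congr fun n => ?_)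
      exact ((hopt n).2.2.orth i j hij).symm
    -- the limit `Vx Vxᵀ = B Bᵀ` determines the column space of `Vx`
    obtain ⟨Z₁, hZ₁⟩ := exists_range_mul_transpose θ.Vx
    obtain ⟨Z₂, hZ₂⟩ := exists_range_mul_transpose B
    rw [hVlim, Matrix.mul_assoc] at hZ₁
    rw [← hVlim, Matrix.mul_assoc] at hZ₂
    exact ⟨hWx, exists_padCols ho hZ₁.symm hZ₂.symm, hbx, θ.Wy, hWyA, hWyB, rfl, hby⟩
  · exact hmodel.not_joint_local hr hry
  · intro M
    have hry' : (0 : ℝ) < ry := by exact_mod_cast hry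
    obtain ⟨C, hC⟩ : ∃ C : ℝ, C = rx + rz + rz * Real.log (1 + frob B) := ⟨_, rfl⟩
    refine ⟨min 1 (Real.exp ((M - C) / (2 * ry))), by positivity, fun γ hγ hlt p hp => ?_⟩
    have h1 := hmodel.cycleLoss_le hr hγ (hlt.trans_le (min_le_left _ _)) hp
    have h2 : Real.log γ < (M - C) / (2 * ry) := by
      rw [Real.log_lt_iff_lt_exp hγ]
      exact hlt.trans_le (min_le_right _ _)
    rw [lt_div_iff₀ (by positivity)] at h2
    rw [← hC] at h1
    linarith
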